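/- **Theorem 1.** Let $\varepsilon\in\{1,0,-1\}$ and let $R(t)\neq 0$, $b(t)$ be smooth functions with $\dot R\neq0$. In coordinates $(t,x,y,z)$ put $\mathrm r^2=x^2+y^2+z^2$, $$w=\frac{2z}{1+\frac{\varepsilon}{4}\mathrm r^2},\qquad L=\frac{R(t)}{1+b(t)\,w},\qquad \Omega=\frac{w}{2z}L=\frac{L}{1+\frac{\varepsilon}{4}\mathrm r^2},\qquad \alpha=R\,\partial_R\ln L,$$ where $\partial_R=\dot R^{-1}\partial_t$ at fixed $x,y,z$. Consider, on a connected open set $U$ of coordinate values on which these expressions are defined and $\alpha\neq 0$, the metric $$ds^2=-\alpha^2dt^2+\Omega^2(dx^2+dy^2+dz^2),$$ and suppose that it solves the Einstein equations $G_{\mu\nu}=T_{\mu\nu}$ for the perfect energy tensor $T_{\mu\nu}=(\rho+p)u_\mu u_\nu+p\,g_{\mu\nu}$ with velocity $u=\alpha^{-1}\partial_t$, energy density $\rho$, nowhere zero on $U$, and pressure $p$, which is not barotropic ($dp\wedge d\rho$ does not vanish identically on $U$). Such a space-time is a thermodynamic Stephani universe in canonical form. Write $x'=\partial_Rx$ and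 $$a=-\frac{R\,\rho'}{3\rho}.$$ Fix a constant $k>0$. The universe is said to represent the local thermal equilibrium evolution of an ideal gas if there are an open dense subset $V\subseteq U$ containing every point of $U$ at which $u(p/\rho)\neq0$, and smooth functions on $V$, namely the matter density $r>0$, the specific internal energy $e$, the temperature $T$ and the specific entropy $s$, each of them a function of $\rho$ and $p$, such that on $V$ $$\nabla_\mu T^{\mu\nu}=0,\qquad \rho=r(1+e),\qquad \nabla_\mu(r u^\mu)=0,\qquad T\,ds=de+p\,d(1/r),\qquad p=k\,r\,T .$$ Then the universe represents the local thermal equilibrium evolution of an ideal gas if and only if there are constants $c_1,c_2\in\mathbb R$ such that on $U$ $$R\,a'=-a\,(c_1a^2+c_2a+1),\qquad b''R=-c_1a^2\,b'.$$ Moreover the expansion factor $R(t)$ satisfies the generalized Friedmann equation $$\rho=\frac{3}{R^2}\left[\dot R^2+\varepsilon-4b^2\right],$$ so that $\rho$, $a$ and $b$ are functions of $R$ only. -/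

import Mathlib

open scoped ContDiff

noncomputable section

namespace Stephani

/-! ### Tensor calculus in a coordinate chart of a space-time -/

/-- Coordinates of a space-time event: `x 0 = t` and `x 1, x 2, x 3` are the Cartesian-like
spatial coordinates `x, y, z`. -/
abbrev Event : Type := Fin 4 → ℝ

/-- The partial derivative `∂_μ f`. -/
def pd (μ : Fin 4) (f : Event → ℝ) (x : Event) : ℝ :=
  fderiv ℝ f x (Pi.single μ 1)

/-- The Christoffel symbols `Γ^l_{μν}` of the metric `g`. -/
def christoffel (g : Event → Matrix (Fin 4) (Fin 4) ℝ) (l μ ν : Fin 4) (x : Event) : ℝ :=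
  (1 / 2) * ∑ σ, (g x)⁻¹ l σ *
    (pd μ (fun y => g y σ ν) x + pd ν (fun y => g y σ μ) x - pd σ (fun y => g y μ ν) x)

/-- The Ricci tensor `R_{μν}` (positive on round spheres). -/
def ricci (g : Event → Matrix (Fin 4) (Fin 4) ℝ) (μ ν : Fin 4) (x : Event) : ℝ :=
  ∑ l, (pd l (christoffel g l μ ν) x - pd ν (christoffel g l μ l) x
    + ∑ σ, (christoffel g l l σ x * christoffel g σ μ ν x
      - christoffel g l ν σ x * christoffel g σ μ l x))

/-- The scalar curvature. -/
def scalarCurvature (g : Event → Matrix (Fin 4) (Fin 4) ℝ) (x : Event) : ℝ :=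
  ∑ μ, ∑ ν, (g x)⁻¹ μ ν * ricci g μ ν x

/-- The Einstein tensor `G_{μν}`. -/
def einstein (g : Event → Matrix (Fin 4) (Fin 4) ℝ) (μ ν : Fin 4) (x : Event) : ℝ :=
  ricci g μ ν x - (1 / 2) * scalarCurvature g x * g x μ ν

/-- The divergence `∇_μ X^μ` of a vector field. -/
def divVec (g : Event → Matrix (Fin 4) (Fin 4) ℝ) (X : Fin 4 → Event → ℝ) (x : Event) : ℝ :=
  ∑ μ, (pd μ (X μ) x + ∑ l, christoffel g μ μ l x * X l x)

/-- The divergence `∇_μ S^{μν}` of a twice contravariant tensor field. -/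
def divTensor (g : Event → Matrix (Fin 4) (Fin 4) ℝ) (S : Fin 4 → Fin 4 → Event → ℝ)
    (ν : Fin 4) (x : Event) : ℝ :=
  ∑ μ, (pd μ (S μ ν) x
    + ∑ l, (christoffel g μ μ l x * S l ν x + christoffel g ν μ l x * S μ l x))

/-- The directional derivative `u(f) = u^μ ∂_μ f`. -/
def along (u : Fin 4 → Event → ℝ) (f : Event → ℝ) (x : Event) : ℝ :=
  ∑ μ, u μ x * pd μ f x

/-! ### Perfect fluids -/

/-- Contravariant components of the perfect energy tensor with velocity `u`, energy density `ρ`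
and pressure `p`, for the signature `(-,+,+,+)`. -/
def energyTensor (g : Event → Matrix (Fin 4) (Fin 4) ℝ) (u : Fin 4 → Event → ℝ)
    (ρ p : Event → ℝ) (μ ν : Fin 4) (x : Event) : ℝ :=
  (ρ x + p x) * u μ x * u ν x + p x * (g x)⁻¹ μ ν

/-- The covariant components `T_{μν}` of the same tensor. -/
def energyTensorCov (g : Event → Matrix (Fin 4) (Fin 4) ℝ) (u : Fin 4 → Event → ℝ)
    (ρ p : Event → ℝ) (μ ν : Fin 4) (x : Event) : ℝ :=
  ∑ κ, ∑ l, g x μ κ * g x ν l * energyTensor g u ρ p κ l x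

/-- A perfect energy tensor is barotropic on `U` if `dp ∧ dρ = 0` there. -/
def Barotropic (ρ p : Event → ℝ) (U : Set Event) : Prop :=
  ∀ x ∈ U, ∀ μ ν : Fin 4, pd μ p x * pd ν ρ x - pd ν p x * pd μ ρ x = 0

/-- The perfect energy tensor `(u, ρ, p)` evolves in local thermal equilibrium on the open set `V`
with matter density `r`, specific internal energy `ie`, temperature `T` and specific entropy `s`. -/
structure LocalThermalEquilibrium (g : Event → Matrix (Fin 4) (Fin 4) ℝ)
    (u : Fin 4 → Event → ℝ) (ρ p : Event → ℝ) (V : Set Event)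
    (r ie T s : Event → ℝ) : Prop where
  smooth_r : ContDiffOn ℝ ∞ r V
  smooth_ie : ContDiffOn ℝ ∞ ie V
  smooth_T : ContDiffOn ℝ ∞ T V
  smooth_s : ContDiffOn ℝ ∞ s V
  r_pos : ∀ x ∈ V, 0 < r x
  /-- energy-momentum conservation -/
  energy_conservation : ∀ x ∈ V, ∀ ν, divTensor g (energyTensor g u ρ p) ν x = 0
  energy_decomposition : ∀ x ∈ V, ρ x = r x * (1 + ie x)
  /-- conservation of matter -/
  matter_conservation : ∀ x ∈ V, divVec g (fun μ y => r y * u μ y) x = 0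
  /-- the Duhem-Gibbs relation `T ds = d(ie) + p d(1/r)` -/
  duhem_gibbs : ∀ x ∈ V, T x • fderiv ℝ s x = fderiv ℝ ie x + p x • fderiv ℝ (fun y => 1 / r y) x
  /-- equations of state: the thermodynamic quantities are functions of `ρ` and `p` -/
  state : ∀ x ∈ V, ∀ y ∈ V, ρ x = ρ y → p x = p y →
    r x = r y ∧ ie x = ie y ∧ T x = T y ∧ s x = s y

/-- The perfect energy tensor `(u, ρ, p)` on `U` represents the local thermal equilibrium evolution
of an ideal gas, `p = k r T`. The thermodynamic quantities may be singular on a nowhere dense set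
of events, and only at events where `u(p/ρ) = 0` (equivalently, where `u(p)/u(ρ) = p/ρ` if
`u(ρ) ≠ 0`). -/
def RepresentsIdealGas (k : ℝ) (g : Event → Matrix (Fin 4) (Fin 4) ℝ)
    (u : Fin 4 → Event → ℝ) (ρ p : Event → ℝ) (U : Set Event) : Prop :=
  ∃ V : Set Event, IsOpen V ∧ V ⊆ U ∧ U ⊆ closure V ∧
    (∀ x ∈ U, along u (fun y => p y / ρ y) x ≠ 0 → x ∈ V) ∧
    ∃ r ie T s : Event → ℝ, LocalThermalEquilibrium g u ρ p V r ie T s ∧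
      ∀ x ∈ V, p x = k * r x * T x

/-! ### The canonical metric of the thermodynamic Stephani universes -/

/-- The derivative `∂_R f = (∂_t f) / (dR/dt)`, at fixed spatial coordinates, with respect to the
expansion factor `R(t)` taken as time coordinate. -/
def dR (R : ℝ → ℝ) (f : Event → ℝ) (x : Event) : ℝ :=
  pd 0 f x / deriv R (x 0)

/-- `1 + ε r² / 4`, with `r² = x² + y² + z²`. -/
def conf (ε : ℝ) (x : Event) : ℝ :=
  1 + ε / 4 * (x 1 ^ 2 + x 2 ^ 2 + x 3 ^ 2)

/-- The space coordinate `w = 2 z / (1 + ε r² / 4)`. -/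
def wCoord (ε : ℝ) (x : Event) : ℝ :=
  2 * x 3 / conf ε x

/-- `L = R(t) / (1 + b(t) w)`. -/
def lFun (ε : ℝ) (R b : ℝ → ℝ) (x : Event) : ℝ :=
  R (x 0) / (1 + b (x 0) * wCoord ε x)

/-- `α = R ∂_R ln L`; `Real.log` is the logarithm of the absolute value. -/
def lapse (ε : ℝ) (R b : ℝ → ℝ) (x : Event) : ℝ :=
  R (x 0) * dR R (fun y => Real.log (lFun ε R b y)) x

/-- `Ω = (w / 2z) L`, where `w / 2z = 1 / (1 + ε r² / 4)`. -/
def omega (ε : ℝ) (R b : ℝ → ℝ) (x : Event) : ℝ :=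
  1 / conf ε x * lFun ε R b x

/-- `ds² = -α² dt² + Ω² (dx² + dy² + dz²)`. -/
def metric (ε : ℝ) (R b : ℝ → ℝ) (x : Event) : Matrix (Fin 4) (Fin 4) ℝ :=
  Matrix.diagonal ![-(lapse ε R b x) ^ 2, (omega ε R b x) ^ 2,
    (omega ε R b x) ^ 2, (omega ε R b x) ^ 2]

/-- The velocity `u = (1/α) ∂_t`. -/
def velocity (ε : ℝ) (R b : ℝ → ℝ) (μ : Fin 4) (x : Event) : ℝ :=
  if μ = 0 then 1 / lapse ε R b x else 0

/-- The times that occur in `U`. -/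
def times (U : Set Event) : Set ℝ := (fun x : Event => x 0) '' U

/-- A thermodynamic Stephani universe on the connected coordinate domain `U`: the canonical metric
with curvature index `ε` and time functions `R`, `b` is regular with non-vanishing expansion
`3 R⁻¹ dR/dt`, it solves the Einstein equations `G_{μν} = T_{μν}` for the perfect energy tensor with
velocity `u = (1/α) ∂_t`, energy density `ρ` and pressure `p`, and it is not barotropic. -/
structure ThermodynamicStephani (ε : ℝ) (R b : ℝ → ℝ) (ρ p : Event → ℝ) (U : Set Event) :
    Prop where
  index : ε = 1 ∨ ε = 0 ∨ ε = -1
  isOpen : IsOpen U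
  isConnected : IsConnected U
  smooth_R : ContDiffOn ℝ ∞ R (times U)
  smooth_b : ContDiffOn ℝ ∞ b (times U)
  R_ne : ∀ t ∈ times U, R t ≠ 0
  expansion : ∀ t ∈ times U, deriv R t ≠ 0
  conf_ne : ∀ x ∈ U, conf ε x ≠ 0
  denom_ne : ∀ x ∈ U, 1 + b (x 0) * wCoord ε x ≠ 0
  lapse_ne : ∀ x ∈ U, lapse ε R b x ≠ 0
  einstein_eq : ∀ x ∈ U, ∀ μ ν, einstein (metric ε R b) μ ν x
    = energyTensorCov (metric ε R b) (velocity ε R b) ρ p μ ν x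
  not_barotropic : ¬ Barotropic ρ p U

/-- `a = - R ∂_R ρ / (3 ρ)`. -/
def aFun (R : ℝ → ℝ) (ρ : Event → ℝ) (x : Event) : ℝ :=
  -(R (x 0) * dR R ρ x) / (3 * ρ x)

/-- A function of time as a function of the event; if `f(t) = F(R(t))`, then `dR` of it is `F'(R)`. -/
def ofTime (f : ℝ → ℝ) (x : Event) : ℝ := f (x 0)

/-- `dR` computes derivatives with respect to `R`. -/
theorem dR_ofTime_comp (R F : ℝ → ℝ) (x : Event) (hR : deriv R (x 0) ≠ 0)
    (hF : DifferentiableAt ℝ F (R (x 0))) :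
    dR R (ofTime (F ∘ R)) x = deriv F (R (x 0)) := by
  have hR' : DifferentiableAt ℝ R (x 0) := by
    by_contra h
    exact hR (deriv_zero_of_not_differentiableAt h)
  have h1 : HasDerivAt (F ∘ R) (deriv F (R (x 0)) * deriv R (x 0)) (x 0) :=
    hF.hasDerivAt.comp (x 0) hR'.hasDerivAt
  have h2 : HasFDerivAt (fun y : Event => y 0)
      (ContinuousLinearMap.proj (R := ℝ) (φ := fun _ : Fin 4 => ℝ) 0) x :=
    (ContinuousLinearMap.proj (R := ℝ) (φ := fun _ : Fin 4 => ℝ) 0).hasFDerivAt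
  have h3 : HasFDerivAt (ofTime (F ∘ R)) _ x := HasDerivAt.comp_hasFDerivAt x h1 h2
  rw [dR, pd, h3.fderiv]
  simp [hR]

end Stephani

end

/-!
The theorem reduces to a problem about the functions of time `R`, `b` and `a`.

*Einstein equations.* With `P = b - R b'` the lapse is `α = (1 + P w) / (1 + b w)`, and
`∂_t ln Ω = α Ṙ / R`: the fluid expands homogeneously. The Ricci tensor of a metric
`-α² dt² + Ω² (dx² + dy² + dz²)` is expressed in the logarithmic gradients of `α` and `Ω`
(`IsoMetric.fluid_equations`). For the canonical metric the component `G_tt` gives the generalized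
Friedmann equation (`density_eq`) and `R_tt` gives `p / ρ = a / α - 1` (`pressure_eq`). The
conservation of energy and momentum follows from these two formulas, so the only conditions left in
the definition of an ideal gas are conservation of matter and the Duhem-Gibbs relation.

*Ideal gas implies the equations.* Along a world line, conservation of matter says that `r Ω³` is
constant, and the time component of the Duhem-Gibbs relation says that `s` is constant wherever
`p ≠ 0`. Then `∂_z s` and `∂_z ln (r Ω³)` are constant along the world line too, and the
`z`-component of the Duhem-Gibbs relation becomes the statement that `(1 + P w) / a` is an affine
function of `b` along it (`affine_along`). At a time with `a b' ≠ 0` all but finitely many values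
of `w` are admissible, and two of them show that `1 / a = A₀ + A₁ b` and `P / a = B₀ + B₁ b`
locally. Differentiating, these relations are the asserted equations with
`c₁ = B₁ A₀ - A₁ B₀` and `c₂ = -(A₀ + B₁)`. The equations make `a b'` a solution of a linear
equation, so that it has no zeros (`ne_zero_of_linear_ode`); since it does not vanish identically
unless the fluid is barotropic, the constants are the same at all times.

*The equations imply an ideal gas.* Put `π = p / ρ` and `Q(π) = 1 + c₂ (1 + π) + c₁ (1 + π)²`. The
equations amount to `R ∂_R π = -a Q(π)` (`pd_ratio_zero`), while `R ∂_R ρ = -3 a ρ`. Hence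
`r = |ρ| exp G(π)` with `G' = -3 π / ((1 + π) Q)` is conserved matter, and with `T = p / (k r)` the
entropy is `s = k (-ln |ρ| + 3 H(π))`, `H' = 1 / Q`. These are functions of `ρ` and `p`, smooth on
the set `Q(π) ≠ 0`, which is dense because `a b'` has no zeros.
-/

namespace Stephani

open scoped Topology

noncomputable section

/-! ### Gradients in coordinates -/

section

/-- `f` is differentiable at `x` with partial derivatives `∂_μ f = v μ`. -/
def HasGrad (f : Event → ℝ) (v : Fin 4 → ℝ) (x : Event) : Prop :=
  DifferentiableAt ℝ f x ∧ ∀ μ, pd μ f x = v μ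

theorem HasGrad.congr {f g : Event → ℝ} {v : Fin 4 → ℝ} {x : Event} (hf : HasGrad f v x)
    (h : g =ᶠ[𝓝 x] f) : HasGrad g v x :=
  ⟨hf.1.congr_of_eventuallyEq h, fun μ => by rw [pd, h.fderiv_eq]; exact hf.2 μ⟩

theorem pd_congr {f g : Event → ℝ} {x : Event} (h : g =ᶠ[𝓝 x] f) (μ : Fin 4) :
    pd μ g x = pd μ f x := by
  rw [pd, pd, h.fderiv_eq]

theorem hasGrad_of_differentiableAt {f : Event → ℝ} {x : Event} (hf : DifferentiableAt ℝ f x) :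
    HasGrad f (fun μ => pd μ f x) x := ⟨hf, fun _ => rfl⟩

theorem hasGrad_const (c : ℝ) (x : Event) : HasGrad (fun _ => c) (fun _ => 0) x :=
  ⟨differentiableAt_const c, fun μ => by simp [pd]⟩

theorem hasGrad_coord (i : Fin 4) (x : Event) :
    HasGrad (fun y => y i) (fun μ => if μ = i then 1 else 0) x := by
  have h2 : HasFDerivAt (fun y : Event => y i)
      (ContinuousLinearMap.proj (R := ℝ) (φ := fun _ : Fin 4 => ℝ) i) x :=
    (ContinuousLinearMap.proj (R := ℝ) (φ := fun _ : Fin 4 => ℝ) i).hasFDerivAt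
  refine ⟨h2.differentiableAt, fun μ => ?_⟩
  rw [pd, h2.fderiv]
  simp [Pi.single_apply, eq_comm]

theorem HasGrad.add {f g : Event → ℝ} {v w : Fin 4 → ℝ} {x : Event} (hf : HasGrad f v x)
    (hg : HasGrad g w x) : HasGrad (fun y => f y + g y) (fun μ => v μ + w μ) x :=
  ⟨hf.1.add hg.1, fun μ => by
    simp only [pd, fderiv_fun_add hf.1 hg.1, ← hf.2, ← hg.2]; rfl⟩

theorem HasGrad.sub {f g : Event → ℝ} {v w : Fin 4 → ℝ} {x : Event} (hf : HasGrad f v x)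
    (hg : HasGrad g w x) : HasGrad (fun y => f y - g y) (fun μ => v μ - w μ) x :=
  ⟨hf.1.sub hg.1, fun μ => by
    simp only [pd, fderiv_fun_sub hf.1 hg.1, ← hf.2, ← hg.2]; rfl⟩

theorem HasGrad.mul {f g : Event → ℝ} {v w : Fin 4 → ℝ} {x : Event} (hf : HasGrad f v x)
    (hg : HasGrad g w x) :
    HasGrad (fun y => f y * g y) (fun μ => v μ * g x + f x * w μ) x :=
  ⟨hf.1.mul hg.1, fun μ => by
    simp only [pd, fderiv_fun_mul hf.1 hg.1, ← hf.2, ← hg.2, FunLike.coe_add, FunLike.coe_smul,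
      Pi.add_apply, Pi.smul_apply, smul_eq_mul]
    ring⟩

/-- Chain rule for a function of one real variable. -/
theorem HasGrad.comp {f : Event → ℝ} {v : Fin 4 → ℝ} {x : Event} {F : ℝ → ℝ} {F' : ℝ}
    (hf : HasGrad f v x) (hF : HasDerivAt F F' (f x)) :
    HasGrad (fun y => F (f y)) (fun μ => F' * v μ) x := by
  have h : HasFDerivAt (fun y => F (f y)) _ x := HasDerivAt.comp_hasFDerivAt x hF hf.1.hasFDerivAt
  refine ⟨h.differentiableAt, fun μ => ?_⟩
  simp [pd, h.fderiv, ← hf.2]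

theorem HasGrad.div {f g : Event → ℝ} {v w : Fin 4 → ℝ} {x : Event} (hf : HasGrad f v x)
    (hg : HasGrad g w x) (h0 : g x ≠ 0) :
    HasGrad (fun y => f y / g y) (fun μ => (v μ * g x - f x * w μ) / g x ^ 2) x := by
  have h := hf.mul (hg.comp (hasDerivAt_inv h0))
  refine ⟨by simpa only [div_eq_mul_inv] using h.1, fun μ => ?_⟩
  have := h.2 μ
  simp only [div_eq_mul_inv] at this ⊢
  rw [this]
  field_simp
  ring

theorem HasGrad.of_eq {f : Event → ℝ} {v w : Fin 4 → ℝ} {x : Event} (hf : HasGrad f v x)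
    (h : ∀ μ, v μ = w μ) : HasGrad f w x :=
  ⟨hf.1, fun μ => (hf.2 μ).trans (h μ)⟩

/-- The gradient of a function of time. -/
theorem hasGrad_time {F : ℝ → ℝ} {F' : ℝ} {x : Event} (hF : HasDerivAt F F' (x 0)) :
    HasGrad (fun y => F (y 0)) (fun μ => if μ = 0 then F' else 0) x :=
  ((hasGrad_coord 0 x).comp hF).of_eq fun μ => by split_ifs <;> simp

/-! ### Curvature of diagonal metrics -/

/-- Logarithmic derivatives of a diagonal metric `diag(d 0, …, d 3)` on the open set `U`:
`∂_μ d_l = 2 d_l B_{lμ}`. -/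
structure DiagonalMetric (d : Fin 4 → Event → ℝ) (B : Fin 4 → Fin 4 → Event → ℝ)
    (U : Set Event) : Prop where
  isOpen : IsOpen U
  ne_zero : ∀ x ∈ U, ∀ l, d l x ≠ 0
  hasGrad : ∀ x ∈ U, ∀ l, HasGrad (d l) (fun μ => 2 * d l x * B l μ x) x
  differentiable : ∀ x ∈ U, ∀ l μ, DifferentiableAt ℝ (B l μ) x

theorem inv_diagonal_apply (v : Fin 4 → ℝ) (hv : ∀ l, v l ≠ 0) :
    (Matrix.diagonal v)⁻¹ = Matrix.diagonal (fun l => (v l)⁻¹) := by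
  apply Matrix.inv_eq_right_inv
  rw [Matrix.diagonal_mul_diagonal]
  simp [hv]

variable {d : Fin 4 → Event → ℝ} {B : Fin 4 → Fin 4 → Event → ℝ} {U : Set Event}

theorem DiagonalMetric.christoffel_eq (h : DiagonalMetric d B U) {x : Event} (hx : x ∈ U)
    (l μ ν : Fin 4) :
    christoffel (fun y => Matrix.diagonal fun i => d i y) l μ ν x =
      (if l = ν then B l μ x else 0) + (if l = μ then B l ν x else 0)
        - (if μ = ν then d μ x / d l x * B μ l x else 0) := by
  have hd := h.ne_zero x hx
  have key : ∀ i j k : Fin 4, pd k (fun y => Matrix.diagonal (fun i => d i y) i j) x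
      = if i = j then 2 * d i x * B i k x else 0 := by
    intro i j k
    by_cases hij : i = j
    · subst hij
      simpa using (h.hasGrad x hx i).2 k
    · simpa [hij] using (hasGrad_const 0 x).2 k
  rw [christoffel, inv_diagonal_apply _ hd, Finset.sum_eq_single l]
  · simp only [Matrix.diagonal_apply_eq, key]
    have := hd l
    by_cases h1 : l = ν <;> by_cases h2 : l = μ <;> by_cases h3 : μ = ν <;>
      simp [h1, h2, h3] <;> subst_vars <;> simp_all <;> field_simp [hd]
  · intro b _ hb
    simp [Matrix.diagonal_apply_ne _ hb.symm]
  · simp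

theorem DiagonalMetric.pd_christoffel (h : DiagonalMetric d B U) {x : Event} (hx : x ∈ U)
    (k l μ ν : Fin 4) :
    pd k (christoffel (fun y => Matrix.diagonal fun i => d i y) l μ ν) x =
      (if l = ν then pd k (B l μ) x else 0) + (if l = μ then pd k (B l ν) x else 0)
        - (if μ = ν then d μ x / d l x *
            (pd k (B μ l) x + 2 * (B μ k x - B l k x) * B μ l x) else 0) := by
  have hd := h.ne_zero x hx
  have he : christoffel (fun y => Matrix.diagonal fun i => d i y) l μ ν =ᶠ[𝓝 x]
      fun y => (if l = ν then B l μ y else 0) + (if l = μ then B l ν y else 0)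
        - (if μ = ν then d μ y / d l y * B μ l y else 0) := by
    filter_upwards [h.isOpen.mem_nhds hx] with y hy using h.christoffel_eq hy l μ ν
  have hite : ∀ (c : Prop) [Decidable c] (f : Event → ℝ) (v : Fin 4 → ℝ), HasGrad f v x →
      HasGrad (fun y => if c then f y else 0) (fun μ => if c then v μ else 0) x := by
    intro c _ f v hf
    by_cases hc : c
    · simpa [hc] using hf
    · simpa [hc] using hasGrad_const 0 x
  have hB : ∀ i j, HasGrad (B i j) (fun μ => pd μ (B i j) x) x := fun i j =>
    hasGrad_of_differentiableAt (h.differentiable x hx i j)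
  have hg := ((hite (l = ν) _ _ (hB l μ)).add (hite (l = μ) _ _ (hB l ν))).sub
    (hite (μ = ν) _ _ (((h.hasGrad x hx μ).div (h.hasGrad x hx l) (hd l)).mul (hB μ l)))
  rw [pd_congr he, hg.2 k]
  have := hd l
  split_ifs <;> field_simp <;> ring

end

/-! ### Metrics with a lapse and an isotropic spatial scale -/

section

/-- The coefficients of the metric `-α² dt² + Ω² (dx² + dy² + dz²)`. -/
def isoCoeff (α Ω : Event → ℝ) : Fin 4 → Event → ℝ :=
  ![fun y => -(α y) ^ 2, fun y => (Ω y) ^ 2, fun y => (Ω y) ^ 2, fun y => (Ω y) ^ 2]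

/-- The logarithmic gradients `A = d ln α` and `W = d ln Ω`, arranged by metric coefficient. -/
def isoLog (A W : Fin 4 → Event → ℝ) : Fin 4 → Fin 4 → Event → ℝ := ![A, W, W, W]

/-- The metric `-α² dt² + Ω² (dx² + dy² + dz²)`. -/
def isoMetric (α Ω : Event → ℝ) (x : Event) : Matrix (Fin 4) (Fin 4) ℝ :=
  Matrix.diagonal ![-(α x) ^ 2, (Ω x) ^ 2, (Ω x) ^ 2, (Ω x) ^ 2]

theorem isoMetric_eq (α Ω : Event → ℝ) :
    isoMetric α Ω = fun y => Matrix.diagonal fun i => isoCoeff α Ω i y := by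
  funext y
  rw [isoMetric]
  congr 1
  funext i
  fin_cases i <;> rfl

/-- On `U`, the lapse `α` and the scale `Ω` do not vanish and have the logarithmic gradients
`A` and `W`. -/
structure IsoMetric (α Ω : Event → ℝ) (A W : Fin 4 → Event → ℝ) (U : Set Event) : Prop where
  isOpen : IsOpen U
  lapse_ne : ∀ x ∈ U, α x ≠ 0
  scale_ne : ∀ x ∈ U, Ω x ≠ 0
  hasGrad_lapse : ∀ x ∈ U, HasGrad α (fun μ => α x * A μ x) x
  hasGrad_scale : ∀ x ∈ U, HasGrad Ω (fun μ => Ω x * W μ x) x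
  diff_A : ∀ x ∈ U, ∀ μ, DifferentiableAt ℝ (A μ) x
  diff_W : ∀ x ∈ U, ∀ μ, DifferentiableAt ℝ (W μ) x

variable {α Ω : Event → ℝ} {A W : Fin 4 → Event → ℝ} {U : Set Event}

theorem IsoMetric.diagonal (h : IsoMetric α Ω A W U) :
    DiagonalMetric (isoCoeff α Ω) (isoLog A W) U where
  isOpen := h.isOpen
  ne_zero := by
    intro x hx l
    have h1 := h.lapse_ne x hx
    have h2 := h.scale_ne x hx
    fin_cases l <;> simp [isoCoeff, h1, h2]
  hasGrad := by
    intro x hx l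
    have hsq : ∀ u : ℝ, HasDerivAt (fun s : ℝ => s ^ 2) (2 * u) u := fun u => by
      simpa using hasDerivAt_pow 2 u
    have h1 := (h.hasGrad_lapse x hx).comp (hsq (α x)).neg
    have h2 := (h.hasGrad_scale x hx).comp (hsq (Ω x))
    fin_cases l
    · exact h1.of_eq fun μ => by simp [isoCoeff, isoLog]; ring
    all_goals exact h2.of_eq fun μ => by simp [isoCoeff, isoLog]; ring
  differentiable := by
    intro x hx l μ
    fin_cases l
    · exact h.diff_A x hx μ
    all_goals exact h.diff_W x hx μ

theorem IsoMetric.ricci_zero (h : IsoMetric α Ω A W U) {x : Event} (hx : x ∈ U) :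
    ricci (isoMetric α Ω) 0 0 x =
      -3 * (pd 0 (W 0) x + W 0 x ^ 2 - A 0 x * W 0 x)
        + (α x / Ω x) ^ 2 * (pd 1 (A 1) x + pd 2 (A 2) x + pd 3 (A 3) x
            + A 1 x * (A 1 x + W 1 x) + A 2 x * (A 2 x + W 2 x) + A 3 x * (A 3 x + W 3 x)) := by
  have h1 := h.lapse_ne x hx
  have h2 := h.scale_ne x hx
  rw [isoMetric_eq]
  simp only [ricci, Fin.sum_univ_four, h.diagonal.christoffel_eq hx, h.diagonal.pd_christoffel hx]
  simp [isoCoeff, isoLog]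
  field_simp
  ring

theorem IsoMetric.ricci_sum (h : IsoMetric α Ω A W U) {x : Event} (hx : x ∈ U) :
    (α x / Ω x) ^ 2 * (ricci (isoMetric α Ω) 1 1 x + ricci (isoMetric α Ω) 2 2 x
        + ricci (isoMetric α Ω) 3 3 x) =
      3 * (pd 0 (W 0) x + 3 * W 0 x ^ 2 - A 0 x * W 0 x)
        - (α x / Ω x) ^ 2 * (pd 1 (A 1) x + pd 2 (A 2) x + pd 3 (A 3) x
            + A 1 x * (A 1 x + W 1 x) + A 2 x * (A 2 x + W 2 x) + A 3 x * (A 3 x + W 3 x)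
            + 4 * (pd 1 (W 1) x + pd 2 (W 2) x + pd 3 (W 3) x)
            + 2 * (W 1 x ^ 2 + W 2 x ^ 2 + W 3 x ^ 2)) := by
  have h1 := h.lapse_ne x hx
  have h2 := h.scale_ne x hx
  rw [isoMetric_eq]
  simp only [ricci, Fin.sum_univ_four, h.diagonal.christoffel_eq hx, h.diagonal.pd_christoffel hx]
  simp [isoCoeff, isoLog]
  field_simp
  ring

theorem IsoMetric.inv (h : IsoMetric α Ω A W U) {x : Event} (hx : x ∈ U) :
    (isoMetric α Ω x)⁻¹ = Matrix.diagonal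
      ![-(α x ^ 2)⁻¹, (Ω x ^ 2)⁻¹, (Ω x ^ 2)⁻¹, (Ω x ^ 2)⁻¹] := by
  rw [isoMetric_eq, inv_diagonal_apply _ (h.diagonal.ne_zero x hx)]
  congr 1
  funext i
  fin_cases i <;> simp [isoCoeff, inv_neg]

/-- The velocity `α⁻¹ ∂_t` of the observers at rest. -/
def restVelocity (α : Event → ℝ) (μ : Fin 4) (x : Event) : ℝ := if μ = 0 then 1 / α x else 0

theorem IsoMetric.energyTensor_eq (h : IsoMetric α Ω A W U) {x : Event} (hx : x ∈ U)
    (ρ p : Event → ℝ) (μ ν : Fin 4) :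
    energyTensor (isoMetric α Ω) (restVelocity α) ρ p μ ν x =
      if μ = ν then (if μ = 0 then ρ x / α x ^ 2 else p x / Ω x ^ 2) else 0 := by
  have h1 := h.lapse_ne x hx
  have h2 := h.scale_ne x hx
  rw [energyTensor, h.inv hx]
  fin_cases μ <;> fin_cases ν <;> simp [restVelocity] <;> field_simp <;>
    ring

theorem IsoMetric.energyTensorCov_eq (h : IsoMetric α Ω A W U) {x : Event} (hx : x ∈ U)
    (ρ p : Event → ℝ) (μ : Fin 4) :
    energyTensorCov (isoMetric α Ω) (restVelocity α) ρ p μ μ x =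
      if μ = 0 then ρ x * α x ^ 2 else p x * Ω x ^ 2 := by
  have h1 := h.lapse_ne x hx
  have h2 := h.scale_ne x hx
  simp only [energyTensorCov, h.energyTensor_eq hx]
  fin_cases μ <;> (simp [Fin.sum_univ_four, isoMetric]; field_simp)

/-- The Hamiltonian constraint and the Raychaudhuri equation for a perfect fluid at rest: the
components `G_tt` and `R_tt` of the Einstein equations. -/
theorem IsoMetric.fluid_equations (h : IsoMetric α Ω A W U) {x : Event} (hx : x ∈ U)
    {ρ p : Event → ℝ} (hE : ∀ μ, einstein (isoMetric α Ω) μ μ x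
      = energyTensorCov (isoMetric α Ω) (restVelocity α) ρ p μ μ x) :
    ρ x = 3 * (W 0 x / α x) ^ 2 - (2 * (pd 1 (W 1) x + pd 2 (W 2) x + pd 3 (W 3) x)
        + (W 1 x ^ 2 + W 2 x ^ 2 + W 3 x ^ 2)) / Ω x ^ 2 ∧
    ρ x + 3 * p x = 2 * (-3 * (pd 0 (W 0) x + W 0 x ^ 2 - A 0 x * W 0 x) / α x ^ 2
      + (pd 1 (A 1) x + pd 2 (A 2) x + pd 3 (A 3) x + A 1 x * (A 1 x + W 1 x)
          + A 2 x * (A 2 x + W 2 x) + A 3 x * (A 3 x + W 3 x)) / Ω x ^ 2) := by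
  have h1 := h.lapse_ne x hx
  have h2 := h.scale_ne x hx
  have r0 := h.ricci_zero hx
  have rs := h.ricci_sum hx
  have hS : scalarCurvature (isoMetric α Ω) x = -ricci (isoMetric α Ω) 0 0 x / α x ^ 2
      + (ricci (isoMetric α Ω) 1 1 x + ricci (isoMetric α Ω) 2 2 x
        + ricci (isoMetric α Ω) 3 3 x) / Ω x ^ 2 := by
    rw [scalarCurvature, h.inv hx]
    simp [Fin.sum_univ_four]
    field_simp
    ring
  have e0 := hE 0
  have e1 := hE 1
  have e2 := hE 2
  have e3 := hE 3
  rw [h.energyTensorCov_eq hx, einstein, hS] at e0 e1 e2 e3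
  generalize ricci (isoMetric α Ω) 0 0 x = R0 at *
  generalize ricci (isoMetric α Ω) 1 1 x = R1 at *
  generalize ricci (isoMetric α Ω) 2 2 x = R2 at *
  generalize ricci (isoMetric α Ω) 3 3 x = R3 at *
  simp only [isoMetric, Matrix.diagonal_apply_eq, Matrix.cons_val, if_true,
    Fin.reduceEq, if_false] at e0 e1 e2 e3
  have hs : R1 + R2 + R3 = Ω x ^ 2 * (2 * ρ x - R0 / α x ^ 2) := by
    field_simp at e0 ⊢
    linear_combination e0
  have hR : 2 * R0 = α x ^ 2 * (ρ x + 3 * p x) := by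
    have : R1 + R2 + R3 - 3 / 2 * (-R0 / α x ^ 2 + (R1 + R2 + R3) / Ω x ^ 2) * Ω x ^ 2
        = 3 * p x * Ω x ^ 2 := by linear_combination e1 + e2 + e3
    rw [hs] at this
    field_simp at this
    linear_combination this / 2
  rw [hs, r0] at rs
  rw [r0] at hR
  constructor
  · field_simp at rs ⊢
    linear_combination rs / 2
  · field_simp at hR ⊢
    linear_combination -hR

/-- Conservation of matter for a fluid at rest. -/
theorem IsoMetric.divVec_eq (h : IsoMetric α Ω A W U) {x : Event} (hx : x ∈ U)
    {r : Event → ℝ} (hr : DifferentiableAt ℝ r x) :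
    divVec (isoMetric α Ω) (fun μ y => r y * restVelocity α μ y) x
      = (pd 0 r x + 3 * W 0 x * r x) / α x := by
  have h1 := h.lapse_ne x hx
  have hg := (hasGrad_of_differentiableAt hr).div (h.hasGrad_lapse x hx) h1
  have e0 : pd 0 (fun y => r y * (α y)⁻¹) x = _ := hg.2 0
  have ei : ∀ i, pd i (fun _ => (0 : ℝ)) x = 0 := (hasGrad_const 0 x).2
  rw [isoMetric_eq]
  simp only [divVec, Fin.sum_univ_four, h.diagonal.christoffel_eq hx]
  simp [restVelocity, isoLog, isoCoeff, e0, ei]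
  field_simp
  ring

theorem IsoMetric.divTensor_eq (h : IsoMetric α Ω A W U) {x : Event} (hx : x ∈ U)
    {ρ p : Event → ℝ} (hρ : DifferentiableAt ℝ ρ x) (hp : DifferentiableAt ℝ p x) (ν : Fin 4) :
    divTensor (isoMetric α Ω) (energyTensor (isoMetric α Ω) (restVelocity α) ρ p) ν x
      = if ν = 0 then (pd 0 ρ x + 3 * W 0 x * (ρ x + p x)) / α x ^ 2
        else (pd ν p x + (ρ x + p x) * A ν x) / Ω x ^ 2 := by
  have h1 := h.lapse_ne x hx
  have h2 := h.scale_ne x hx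
  have hsq : ∀ u : ℝ, HasDerivAt (fun s : ℝ => s ^ 2) (2 * u) u := fun u => by
    simpa using hasDerivAt_pow 2 u
  have hg0 := (hasGrad_of_differentiableAt hρ).div ((h.hasGrad_lapse x hx).comp (hsq (α x)))
    (pow_ne_zero 2 h1)
  have hg1 := (hasGrad_of_differentiableAt hp).div ((h.hasGrad_scale x hx).comp (hsq (Ω x)))
    (pow_ne_zero 2 h2)
  have key : ∀ k μ ν, pd k (energyTensor (isoMetric α Ω) (restVelocity α) ρ p μ ν) x =
      if μ = ν then (if μ = 0 then pd k (fun y => ρ y / α y ^ 2) x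
        else pd k (fun y => p y / Ω y ^ 2) x) else 0 := by
    intro k μ ν
    have : energyTensor (isoMetric α Ω) (restVelocity α) ρ p μ ν =ᶠ[𝓝 x]
        fun y => if μ = ν then (if μ = 0 then ρ y / α y ^ 2 else p y / Ω y ^ 2) else 0 := by
      filter_upwards [h.isOpen.mem_nhds hx] with y hy using h.energyTensor_eq hy ρ p μ ν
    rw [pd_congr this]
    split_ifs
    · rfl
    · rfl
    · exact (hasGrad_const 0 x).2 k
  simp only [divTensor, key, hg0.2, hg1.2, h.energyTensor_eq hx]
  rw [isoMetric_eq]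
  simp only [Fin.sum_univ_four, h.diagonal.christoffel_eq hx]
  fin_cases ν <;> simp [isoLog, isoCoeff] <;> field_simp <;> ring

end

section

/-! ### Functions of time -/

theorem smooth_deriv {f : ℝ → ℝ} {I : Set ℝ} (hf : ContDiffOn ℝ ∞ f I) (hI : IsOpen I) :
    ContDiffOn ℝ ∞ (deriv f) I :=
  hf.deriv_of_isOpen hI (by simp)

theorem smooth_hasDerivAt {f : ℝ → ℝ} {I : Set ℝ} (hf : ContDiffOn ℝ ∞ f I) (hI : IsOpen I)
    {t : ℝ} (ht : t ∈ I) : HasDerivAt f (deriv f t) t :=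
  ((hf.contDiffAt (hI.mem_nhds ht)).differentiableAt (by simp)).hasDerivAt

/-- The derivative `f' = df/dR` of a function of time with respect to the expansion factor. -/
def slope (R f : ℝ → ℝ) (t : ℝ) : ℝ := deriv f t / deriv R t

/-- The function `P = b - R b'`; the lapse is `(1 + P w) / (1 + b w)`. -/
def shifted (R b : ℝ → ℝ) (t : ℝ) : ℝ := b t - R t * slope R b t

/-- The energy density given by the generalized Friedmann equation. -/
def friedmann (ε : ℝ) (R b : ℝ → ℝ) (t : ℝ) : ℝ :=
  3 / R t ^ 2 * (deriv R t ^ 2 + ε - 4 * b t ^ 2)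

/-- The function `a = - R ρ' / (3 ρ)` of time. -/
def aTime (ε : ℝ) (R b : ℝ → ℝ) (t : ℝ) : ℝ :=
  -(R t * slope R (friedmann ε R b) t) / (3 * friedmann ε R b t)

theorem slope_smooth {R f : ℝ → ℝ} {I : Set ℝ} (hI : IsOpen I) (hR : ContDiffOn ℝ ∞ R I)
    (hR' : ∀ t ∈ I, deriv R t ≠ 0) (hf : ContDiffOn ℝ ∞ f I) : ContDiffOn ℝ ∞ (slope R f) I :=
  (smooth_deriv hf hI).div (smooth_deriv hR hI) hR'

theorem shifted_smooth {R b : ℝ → ℝ} {I : Set ℝ} (hI : IsOpen I) (hR : ContDiffOn ℝ ∞ R I)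
    (hR' : ∀ t ∈ I, deriv R t ≠ 0) (hb : ContDiffOn ℝ ∞ b I) : ContDiffOn ℝ ∞ (shifted R b) I :=
  hb.sub (hR.mul (slope_smooth hI hR hR' hb))

theorem friedmann_smooth {ε : ℝ} {R b : ℝ → ℝ} {I : Set ℝ} (hI : IsOpen I)
    (hR : ContDiffOn ℝ ∞ R I) (hR0 : ∀ t ∈ I, R t ≠ 0) (hb : ContDiffOn ℝ ∞ b I) :
    ContDiffOn ℝ ∞ (friedmann ε R b) I :=
  (contDiffOn_const.div (hR.pow 2) fun t ht => pow_ne_zero 2 (hR0 t ht)).mul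
    ((((smooth_deriv hR hI).pow 2).add contDiffOn_const).sub (contDiffOn_const.mul (hb.pow 2)))

theorem aTime_smooth {ε : ℝ} {R b : ℝ → ℝ} {I : Set ℝ} (hI : IsOpen I)
    (hR : ContDiffOn ℝ ∞ R I) (hR0 : ∀ t ∈ I, R t ≠ 0) (hR' : ∀ t ∈ I, deriv R t ≠ 0)
    (hb : ContDiffOn ℝ ∞ b I) (hρ : ∀ t ∈ I, friedmann ε R b t ≠ 0) :
    ContDiffOn ℝ ∞ (aTime ε R b) I :=
  (hR.mul (slope_smooth hI hR hR' (friedmann_smooth hI hR hR0 hb))).neg.div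
    (contDiffOn_const.mul (friedmann_smooth hI hR hR0 hb)) fun t ht =>
      mul_ne_zero three_ne_zero (hρ t ht)

theorem isOpen_times {U : Set Event} (hU : IsOpen U) : IsOpen (times U) :=
  isOpenMap_eval (0 : Fin 4) U hU

theorem isPreconnected_times {U : Set Event} (hU : IsPreconnected U) : IsPreconnected (times U) :=
  hU.image _ (continuous_apply (0 : Fin 4)).continuousOn

theorem mem_times {U : Set Event} {x : Event} (hx : x ∈ U) : x 0 ∈ times U := ⟨x, hx, rfl⟩

/-! ### The canonical metric -/

/-- The function `1 + ε r² / 4 + 2 β(t) z`. The canonical metric has the scale `R` over this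
function for `β = b`, and its lapse is the quotient of those for `β = P` and `β = b`. -/
def quad (ε : ℝ) (β : ℝ → ℝ) (x : Event) : ℝ := conf ε x + 2 * β (x 0) * x 3

theorem quad_shifted (ε : ℝ) (R b : ℝ → ℝ) (x : Event) : quad ε (shifted R b) x
    = quad ε b x - 2 * R (x 0) * (deriv b (x 0) / deriv R (x 0)) * x 3 := by
  rw [quad, quad, shifted, slope]
  ring

/-- The partial derivatives of `quad`. -/
def quadGrad (ε : ℝ) (β : ℝ → ℝ) : Fin 4 → Event → ℝ :=
  ![fun x => 2 * deriv β (x 0) * x 3, fun x => ε / 2 * x 1, fun x => ε / 2 * x 2,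
    fun x => ε / 2 * x 3 + 2 * β (x 0)]

theorem conf_hasGrad (ε : ℝ) (x : Event) :
    HasGrad (conf ε) ![0, ε / 2 * x 1, ε / 2 * x 2, ε / 2 * x 3] x := by
  have hsq : ∀ i : Fin 4,
      HasGrad (fun y => y i ^ 2) (fun μ => 2 * x i * if μ = i then 1 else 0) x := fun i =>
    (hasGrad_coord i x).comp (by simpa using hasDerivAt_pow 2 (x i))
  refine ((hasGrad_const 1 x).add ((hasGrad_const (ε / 4) x).mul
    (((hsq 1).add (hsq 2)).add (hsq 3)))).of_eq fun μ => ?_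
  fin_cases μ <;> simp <;> ring

theorem quad_hasGrad {ε : ℝ} {β : ℝ → ℝ} {x : Event} (hβ : DifferentiableAt ℝ β (x 0)) :
    HasGrad (quad ε β) (fun μ => quadGrad ε β μ x) x := by
  refine ((conf_hasGrad ε x).add (((hasGrad_const 2 x).mul (hasGrad_time hβ.hasDerivAt)).mul
    (hasGrad_coord 3 x))).of_eq fun μ => ?_
  fin_cases μ <;> simp [quadGrad]

theorem quadGrad_differentiable {ε : ℝ} {β : ℝ → ℝ} {x : Event}
    (hβ : DifferentiableAt ℝ β (x 0)) (hβ' : DifferentiableAt ℝ (deriv β) (x 0)) (μ : Fin 4) :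
    DifferentiableAt ℝ (quadGrad ε β μ) x := by
  have h0 := (hasGrad_time hβ.hasDerivAt).1
  have h1 := (hasGrad_time hβ'.hasDerivAt).1
  fin_cases μ <;> simp only [quadGrad, Fin.zero_eta, Fin.mk_one, Fin.reduceFinMk, Matrix.cons_val]
    <;> fun_prop

theorem quadGrad_pd_self {ε : ℝ} {β : ℝ → ℝ} {x : Event} (hβ : DifferentiableAt ℝ β (x 0))
    {i : Fin 4} (hi : i ≠ 0) : pd i (quadGrad ε β i) x = ε / 2 := by
  have hc : ∀ i : Fin 4, HasGrad (fun y : Event => ε / 2 * y i) _ x := fun i =>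
    (hasGrad_const (ε / 2) x).mul (hasGrad_coord i x)
  have h3 := (hc 3).add ((hasGrad_const 2 x).mul (hasGrad_time hβ.hasDerivAt))
  fin_cases i
  · exact absurd rfl hi
  · exact ((hc 1).2 1).trans (by simp)
  · exact ((hc 2).2 2).trans (by simp)
  · exact (h3.2 3).trans (by simp)

theorem quadGrad_div_pd {ε : ℝ} {β : ℝ → ℝ} {x : Event} (h1 : DifferentiableAt ℝ β (x 0))
    (h2 : DifferentiableAt ℝ (deriv β) (x 0)) (h0 : quad ε β x ≠ 0) {i : Fin 4} (hi : i ≠ 0) :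
    pd i (fun y => quadGrad ε β i y / quad ε β y) x
      = (ε / 2 * quad ε β x - quadGrad ε β i x ^ 2) / quad ε β x ^ 2 := by
  refine (((hasGrad_of_differentiableAt (quadGrad_differentiable h1 h2 i)).div
    (quad_hasGrad h1) h0).2 i).trans ?_
  beta_reduce
  rw [quadGrad_pd_self h1 hi]
  ring

/-- The logarithmic gradient of the lapse. -/
def lapseLog (ε : ℝ) (R b : ℝ → ℝ) (μ : Fin 4) (x : Event) : ℝ :=
  quadGrad ε (shifted R b) μ x / quad ε (shifted R b) x - quadGrad ε b μ x / quad ε b x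

/-- The logarithmic gradient of the scale. -/
def scaleLog (ε : ℝ) (R b : ℝ → ℝ) (μ : Fin 4) (x : Event) : ℝ :=
  (if μ = 0 then deriv R (x 0) / R (x 0) else 0) - quadGrad ε b μ x / quad ε b x

variable {ε : ℝ} {R b : ℝ → ℝ} {ρ p : Event → ℝ} {U : Set Event}

namespace ThermodynamicStephani

variable (hS : ThermodynamicStephani ε R b ρ p U)
include hS

theorem smooth_shifted : ContDiffOn ℝ ∞ (shifted R b) (times U) :=
  shifted_smooth (isOpen_times hS.isOpen) hS.smooth_R hS.expansion hS.smooth_b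

theorem one_add_eq {x : Event} (hx : x ∈ U) (β : ℝ → ℝ) :
    1 + β (x 0) * wCoord ε x = quad ε β x / conf ε x := by
  have h1 := hS.conf_ne x hx
  rw [quad, wCoord]
  field_simp

theorem quad_ne {x : Event} (hx : x ∈ U) : quad ε b x ≠ 0 := by
  have h := hS.denom_ne x hx
  rw [hS.one_add_eq hx] at h
  exact fun h0 => h (by simp [h0])

theorem omega_eq {x : Event} (hx : x ∈ U) : omega ε R b x = R (x 0) / quad ε b x := by
  have h1 := hS.conf_ne x hx
  have h2 := hS.quad_ne hx
  rw [omega, lFun, hS.one_add_eq hx]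
  field_simp

theorem lapse_eq {x : Event} (hx : x ∈ U) :
    lapse ε R b x = quad ε (shifted R b) x / quad ε b x := by
  have hI := isOpen_times hS.isOpen
  have h1 := hS.conf_ne x hx
  have h2 := hS.quad_ne hx
  have h3 := hS.R_ne _ (mem_times hx)
  have h4 := hS.expansion _ (mem_times hx)
  have gR := hasGrad_time (x := x) (smooth_hasDerivAt hS.smooth_R hI (mem_times hx))
  have gb := quad_hasGrad (ε := ε)
    (smooth_hasDerivAt hS.smooth_b hI (mem_times hx)).differentiableAt
  have gL : HasGrad (lFun ε R b) _ x :=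
    ((gR.mul (conf_hasGrad ε x)).div gb h2).congr (by
      filter_upwards [hS.isOpen.mem_nhds hx] with y hy
      have := hS.conf_ne y hy
      have := hS.quad_ne hy
      rw [lFun, hS.one_add_eq hy]
      field_simp)
  have hL : lFun ε R b x = R (x 0) * conf ε x / quad ε b x := by
    rw [lFun, hS.one_add_eq hx]
    field_simp
  have hlog := (gL.comp (Real.hasDerivAt_log (by rw [hL]; positivity))).2 0
  rw [lapse, dR, hlog, hL]
  rw [quad_shifted]
  simp only [quadGrad, Matrix.cons_val, if_true]
  field_simp
  ring

theorem quad_shifted_ne {x : Event} (hx : x ∈ U) : quad ε (shifted R b) x ≠ 0 := by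
  have h := hS.lapse_ne x hx
  rw [hS.lapse_eq hx] at h
  exact fun h0 => h (by simp [h0])

theorem differentiableAt_b {x : Event} (hx : x ∈ U) : DifferentiableAt ℝ b (x 0) :=
  (smooth_hasDerivAt hS.smooth_b (isOpen_times hS.isOpen) (mem_times hx)).differentiableAt

theorem differentiableAt_deriv_b {x : Event} (hx : x ∈ U) : DifferentiableAt ℝ (deriv b) (x 0) :=
  (smooth_hasDerivAt (smooth_deriv hS.smooth_b (isOpen_times hS.isOpen)) (isOpen_times hS.isOpen)
    (mem_times hx)).differentiableAt

theorem differentiableAt_shifted {x : Event} (hx : x ∈ U) :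
    DifferentiableAt ℝ (shifted R b) (x 0) :=
  (smooth_hasDerivAt hS.smooth_shifted (isOpen_times hS.isOpen) (mem_times hx)).differentiableAt

theorem differentiableAt_deriv_shifted {x : Event} (hx : x ∈ U) :
    DifferentiableAt ℝ (deriv (shifted R b)) (x 0) :=
  (smooth_hasDerivAt (smooth_deriv hS.smooth_shifted (isOpen_times hS.isOpen))
    (isOpen_times hS.isOpen) (mem_times hx)).differentiableAt

theorem hasDerivAt_R {t : ℝ} (ht : t ∈ times U) : HasDerivAt R (deriv R t) t :=
  smooth_hasDerivAt hS.smooth_R (isOpen_times hS.isOpen) ht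

theorem hasDerivAt_deriv_R {t : ℝ} (ht : t ∈ times U) :
    HasDerivAt (deriv R) (deriv (deriv R) t) t :=
  smooth_hasDerivAt (smooth_deriv hS.smooth_R (isOpen_times hS.isOpen)) (isOpen_times hS.isOpen) ht

/-- The Hubble factor `Ṙ / R`. -/
theorem hasDerivAt_hubble {t : ℝ} (ht : t ∈ times U) :
    HasDerivAt (fun s => deriv R s / R s)
      ((deriv (deriv R) t * R t - deriv R t * deriv R t) / R t ^ 2) t :=
  (hS.hasDerivAt_deriv_R ht).div (hS.hasDerivAt_R ht) (hS.R_ne t ht)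

theorem isoMetric : IsoMetric (lapse ε R b) (omega ε R b) (lapseLog ε R b) (scaleLog ε R b) U where
  isOpen := hS.isOpen
  lapse_ne := hS.lapse_ne
  scale_ne := by
    intro x hx
    rw [hS.omega_eq hx]
    exact div_ne_zero (hS.R_ne _ (mem_times hx)) (hS.quad_ne hx)
  hasGrad_lapse := by
    intro x hx
    have h2 := hS.quad_ne hx
    have h3 := hS.quad_shifted_ne hx
    refine (((quad_hasGrad (hS.differentiableAt_shifted hx)).div
      (quad_hasGrad (hS.differentiableAt_b hx)) h2).congr
      (by filter_upwards [hS.isOpen.mem_nhds hx] with y hy using hS.lapse_eq hy)).of_eq fun μ => ?_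
    rw [hS.lapse_eq hx, lapseLog]
    field_simp
  hasGrad_scale := by
    intro x hx
    have h2 := hS.quad_ne hx
    have h3 := hS.R_ne _ (mem_times hx)
    refine (((hasGrad_time (hS.hasDerivAt_R (mem_times hx))).div
      (quad_hasGrad (hS.differentiableAt_b hx)) h2).congr
      (by filter_upwards [hS.isOpen.mem_nhds hx] with y hy using hS.omega_eq hy)).of_eq fun μ => ?_
    rw [hS.omega_eq hx, scaleLog]
    split_ifs <;> field_simp <;> ring
  diff_A := by
    intro x hx μ
    have h1 := (quad_hasGrad (ε := ε) (hS.differentiableAt_shifted hx)).1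
    have h2 := (quad_hasGrad (ε := ε) (hS.differentiableAt_b hx)).1
    have h3 := quadGrad_differentiable (ε := ε) (hS.differentiableAt_shifted hx)
      (hS.differentiableAt_deriv_shifted hx) μ
    have h4 := quadGrad_differentiable (ε := ε) (hS.differentiableAt_b hx)
      (hS.differentiableAt_deriv_b hx) μ
    exact (((hasGrad_of_differentiableAt h3).div (hasGrad_of_differentiableAt h1)
      (hS.quad_shifted_ne hx)).sub ((hasGrad_of_differentiableAt h4).div
      (hasGrad_of_differentiableAt h2) (hS.quad_ne hx))).1
  diff_W := by
    intro x hx μ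
    have h2 := (quad_hasGrad (ε := ε) (hS.differentiableAt_b hx)).1
    have h4 := quadGrad_differentiable (ε := ε) (hS.differentiableAt_b hx)
      (hS.differentiableAt_deriv_b hx) μ
    have h5 := (hasGrad_time (hS.hasDerivAt_hubble (mem_times hx))).1
    refine DifferentiableAt.fun_sub ?_ ((hasGrad_of_differentiableAt h4).div
      (hasGrad_of_differentiableAt h2) (hS.quad_ne hx)).1
    split_ifs
    · exact h5
    · exact differentiableAt_const _

/-- The observers at rest expand homogeneously: `∂_t ln Ω = α Ṙ / R`. -/
theorem scaleLog_zero {x : Event} (hx : x ∈ U) :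
    scaleLog ε R b 0 x = lapse ε R b x * (deriv R (x 0) / R (x 0)) := by
  have h2 := hS.quad_ne hx
  have h3 := hS.R_ne _ (mem_times hx)
  have h4 := hS.expansion _ (mem_times hx)
  rw [hS.lapse_eq hx, quad_shifted, scaleLog]
  simp only [quadGrad, Matrix.cons_val, if_true]
  field_simp

theorem pd_scaleLog_zero {x : Event} (hx : x ∈ U) :
    pd 0 (scaleLog ε R b 0) x = lapse ε R b x * (lapseLog ε R b 0 x * (deriv R (x 0) / R (x 0))
      + (deriv (deriv R) (x 0) * R (x 0) - deriv R (x 0) * deriv R (x 0)) / R (x 0) ^ 2) := by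
  have hg := (hS.isoMetric.hasGrad_lapse x hx).mul
    (hasGrad_time (hS.hasDerivAt_hubble (mem_times hx)))
  rw [pd_congr (by filter_upwards [hS.isOpen.mem_nhds hx] with y hy using hS.scaleLog_zero hy),
    hg.2 0]
  simp only [if_true]
  ring

end ThermodynamicStephani

end

/-! ### Energy density and pressure -/

section

variable {ε : ℝ} {R b : ℝ → ℝ} {ρ p : Event → ℝ} {U : Set Event}

namespace ThermodynamicStephani

variable (hS : ThermodynamicStephani ε R b ρ p U)
include hS

theorem pd_lapseLog {x : Event} (hx : x ∈ U) {i : Fin 4} (hi : i ≠ 0) :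
    pd i (lapseLog ε R b i) x =
      (ε / 2 * quad ε (shifted R b) x - quadGrad ε (shifted R b) i x ^ 2)
          / quad ε (shifted R b) x ^ 2
        - (ε / 2 * quad ε b x - quadGrad ε b i x ^ 2) / quad ε b x ^ 2 := by
  have h1 := quadGrad_differentiable (ε := ε) (hS.differentiableAt_shifted hx)
    (hS.differentiableAt_deriv_shifted hx) i
  have h2 := quadGrad_differentiable (ε := ε) (hS.differentiableAt_b hx)
    (hS.differentiableAt_deriv_b hx) i
  have g1 := (hasGrad_of_differentiableAt h1).div (quad_hasGrad (hS.differentiableAt_shifted hx))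
    (hS.quad_shifted_ne hx)
  have g2 := (hasGrad_of_differentiableAt h2).div (quad_hasGrad (hS.differentiableAt_b hx))
    (hS.quad_ne hx)
  rw [← quadGrad_div_pd (hS.differentiableAt_shifted hx) (hS.differentiableAt_deriv_shifted hx)
    (hS.quad_shifted_ne hx) hi, ← quadGrad_div_pd (hS.differentiableAt_b hx)
    (hS.differentiableAt_deriv_b hx) (hS.quad_ne hx) hi, g1.2, g2.2]
  exact (g1.sub g2).2 i

theorem pd_scaleLog {x : Event} (hx : x ∈ U) {i : Fin 4} (hi : i ≠ 0) :
    pd i (scaleLog ε R b i) x =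
      -((ε / 2 * quad ε b x - quadGrad ε b i x ^ 2) / quad ε b x ^ 2) := by
  have h2 := quadGrad_differentiable (ε := ε) (hS.differentiableAt_b hx)
    (hS.differentiableAt_deriv_b hx) i
  have g2 := (hasGrad_of_differentiableAt h2).div (quad_hasGrad (hS.differentiableAt_b hx))
    (hS.quad_ne hx)
  have he : scaleLog ε R b i = fun y => 0 - quadGrad ε b i y / quad ε b y := by
    funext y
    simp [scaleLog, hi]
  rw [← quadGrad_div_pd (hS.differentiableAt_b hx)
    (hS.differentiableAt_deriv_b hx) (hS.quad_ne hx) hi, g2.2, he]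
  simpa using ((hasGrad_const 0 x).sub g2).2 i

/-- The generalized Friedmann equation. -/
theorem density_eq {x : Event} (hx : x ∈ U) : ρ x = friedmann ε R b (x 0) := by
  have h2 := hS.quad_ne hx
  have h3 := hS.R_ne _ (mem_times hx)
  have h4 := hS.lapse_ne x hx
  have h := (hS.isoMetric.fluid_equations hx fun μ => hS.einstein_eq x hx μ μ).1
  rw [hS.scaleLog_zero hx, hS.omega_eq hx, hS.pd_scaleLog hx (by decide),
    hS.pd_scaleLog hx (by decide), hS.pd_scaleLog hx (by decide)] at h
  have hc : lapse ε R b x * (deriv R (x 0) / R (x 0)) / lapse ε R b x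
      = deriv R (x 0) / R (x 0) := by field_simp
  have hq : quadGrad ε b 1 x ^ 2 + quadGrad ε b 2 x ^ 2 + quadGrad ε b 3 x ^ 2
      = ε * quad ε b x + 4 * b (x 0) ^ 2 - ε := by
    simp only [quadGrad, quad, conf, Matrix.cons_val]
    ring
  rw [hc] at h
  simp only [scaleLog, Fin.reduceEq, if_false] at h
  rw [h, friedmann]
  field_simp
  linear_combination -3 * hq

theorem ne_zero_friedmann (hρ : ∀ x ∈ U, ρ x ≠ 0) {t : ℝ} (ht : t ∈ times U) :
    friedmann ε R b t ≠ 0 := by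
  obtain ⟨x, hx, rfl⟩ := ht
  exact hS.density_eq hx ▸ hρ x hx

/-- The pressure: `p / ρ = a / α - 1`. -/
theorem pressure_eq (hρ : ∀ x ∈ U, ρ x ≠ 0) {x : Event} (hx : x ∈ U) :
    p x = friedmann ε R b (x 0) * (aTime ε R b (x 0) / lapse ε R b x - 1) := by
  have h1 := hS.quad_shifted_ne hx
  have h2 := hS.quad_ne hx
  have h3 := hS.R_ne _ (mem_times hx)
  have h4 := hS.lapse_ne x hx
  have h5 := hS.expansion _ (mem_times hx)
  have h6 := hS.ne_zero_friedmann hρ (mem_times hx)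
  have h := (hS.isoMetric.fluid_equations hx fun μ => hS.einstein_eq x hx μ μ).2
  rw [hS.pd_scaleLog_zero hx, hS.scaleLog_zero hx, hS.omega_eq hx, hS.pd_lapseLog hx (by decide),
    hS.pd_lapseLog hx (by decide), hS.pd_lapseLog hx (by decide), hS.density_eq hx] at h
  -- the derivative of the energy density
  have hd := ((((hS.hasDerivAt_R (mem_times hx)).pow 2).inv (pow_ne_zero 2 h3)).const_mul 3).mul
    ((((hS.hasDerivAt_deriv_R (mem_times hx)).pow 2).add_const ε).sub
      (((hS.differentiableAt_b hx).hasDerivAt.pow 2).const_mul 4))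
  have hd' : deriv (friedmann ε R b) (x 0) = _ := hd.deriv
  have ha : friedmann ε R b (x 0) * aTime ε R b (x 0)
      = -(R (x 0) * slope R (friedmann ε R b) (x 0)) / 3 := by
    rw [aTime]
    field_simp
  have e1 : quadGrad ε b 1 x ^ 2 + quadGrad ε b 2 x ^ 2 + quadGrad ε b 3 x ^ 2
      = ε * quad ε b x + 4 * b (x 0) ^ 2 - ε := by
    simp only [quadGrad, quad, conf, Matrix.cons_val]
    ring
  have e2 : quadGrad ε (shifted R b) 1 x * quadGrad ε b 1 x
      + quadGrad ε (shifted R b) 2 x * quadGrad ε b 2 x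
      + quadGrad ε (shifted R b) 3 x * quadGrad ε b 3 x
      = ε / 2 * (quad ε (shifted R b) x + quad ε b x) + 4 * b (x 0) * shifted R b (x 0) - ε := by
    simp only [quadGrad, quad, conf, Matrix.cons_val]
    ring
  have hα := hS.lapse_eq hx
  have hP : shifted R b (x 0) = b (x 0) - R (x 0) * (deriv b (x 0) / deriv R (x 0)) := rfl
  have hf : friedmann ε R b (x 0)
    = 3 / R (x 0) ^ 2 * (deriv R (x 0) ^ 2 + ε - 4 * b (x 0) ^ 2) := rfl
  simp only [lapseLog, scaleLog, Fin.reduceEq, if_false] at h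
  rw [slope, hd'] at ha
  generalize lapse ε R b x = α at *
  generalize quad ε (shifted R b) x = M at *
  generalize quad ε b x = N at *
  generalize quadGrad ε (shifted R b) 1 x = m1 at *
  generalize quadGrad ε (shifted R b) 2 x = m2 at *
  generalize quadGrad ε (shifted R b) 3 x = m3 at *
  generalize quadGrad ε b 1 x = n1 at *
  generalize quadGrad ε b 2 x = n2 at *
  generalize quadGrad ε b 3 x = n3 at *
  generalize quadGrad ε (shifted R b) 0 x / M - quadGrad ε b 0 x / N = A0 at *
  -- the part of the Ricci component that comes from the spatial derivatives
  have hspace : (ε / 2 * M - m1 ^ 2) / M ^ 2 - (ε / 2 * N - n1 ^ 2) / N ^ 2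
      + ((ε / 2 * M - m2 ^ 2) / M ^ 2 - (ε / 2 * N - n2 ^ 2) / N ^ 2)
      + ((ε / 2 * M - m3 ^ 2) / M ^ 2 - (ε / 2 * N - n3 ^ 2) / N ^ 2)
      + (m1 / M - n1 / N) * (m1 / M - n1 / N + (0 - n1 / N))
      + (m2 / M - n2 / N) * (m2 / M - n2 / N + (0 - n2 / N))
      + (m3 / M - n3 / N) * (m3 / M - n3 / N + (0 - n3 / N))
      = ((12 * b (x 0) * (b (x 0) - shifted R b (x 0)) + 3 * (ε - 4 * b (x 0) ^ 2)) * (N / M)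
          - 3 * (ε - 4 * b (x 0) ^ 2)) / N ^ 2 := by
    field_simp
    linear_combination 6 * M ^ 2 * e1 - 6 * M * N * e2
  rw [hspace, hP] at h
  rw [mul_sub, mul_one, mul_div_assoc', ha]
  subst hα
  simp only [Pi.pow_apply, Pi.sub_apply, Pi.inv_apply] at *
  rw [hf] at h ⊢
  field_simp at h ⊢
  linear_combination R (x 0) * h / 3

end ThermodynamicStephani

end

/-! ### Kinematics and thermodynamics of the fluid -/

section

variable {ε : ℝ} {R b : ℝ → ℝ} {ρ p : Event → ℝ} {U : Set Event}

theorem dR_eq_slope {f : Event → ℝ} {F : ℝ → ℝ} {x : Event}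
    (h : f =ᶠ[𝓝 x] fun y => F (y 0)) (hF : DifferentiableAt ℝ F (x 0)) :
    dR R f x = slope R F (x 0) := by
  simp only [dR, slope, pd_congr h, (hasGrad_time hF.hasDerivAt).2 0, if_true]

theorem lapseLog_spatial {x : Event} (hb : slope R b (x 0) = 0) {i : Fin 4}
    (hi : i ≠ 0) : lapseLog ε R b i x = 0 := by
  have hP : shifted R b (x 0) = b (x 0) := by simp [shifted, hb]
  have hq : quad ε (shifted R b) x = quad ε b x := by simp [quad, hP]
  have hg : quadGrad ε (shifted R b) i x = quadGrad ε b i x := by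
    fin_cases i
    · exact absurd rfl hi
    all_goals simp [quadGrad, hP]
  rw [lapseLog, hq, hg, sub_self]

namespace ThermodynamicStephani

variable (hS : ThermodynamicStephani ε R b ρ p U)
include hS

theorem smooth_slope : ContDiffOn ℝ ∞ (slope R b) (times U) :=
  slope_smooth (isOpen_times hS.isOpen) hS.smooth_R hS.expansion hS.smooth_b

theorem smooth_density : ContDiffOn ℝ ∞ (friedmann ε R b) (times U) :=
  friedmann_smooth (isOpen_times hS.isOpen) hS.smooth_R hS.R_ne hS.smooth_b

theorem smooth_aTime (hρ : ∀ x ∈ U, ρ x ≠ 0) : ContDiffOn ℝ ∞ (aTime ε R b) (times U) :=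
  aTime_smooth (isOpen_times hS.isOpen) hS.smooth_R hS.R_ne hS.expansion hS.smooth_b
    fun _ => hS.ne_zero_friedmann hρ

theorem hasDerivAt_b {t : ℝ} (ht : t ∈ times U) : HasDerivAt b (deriv R t * slope R b t) t := by
  have h := smooth_hasDerivAt hS.smooth_b (isOpen_times hS.isOpen) ht
  rwa [slope, mul_div_cancel₀ _ (hS.expansion t ht)]

theorem hasDerivAt_slope {t : ℝ} (ht : t ∈ times U) :
    HasDerivAt (slope R b) (deriv R t * slope R (slope R b) t) t := by
  have h := smooth_hasDerivAt hS.smooth_slope (isOpen_times hS.isOpen) ht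
  rwa [slope, mul_div_cancel₀ _ (hS.expansion t ht)]

theorem hasDerivAt_aTime (hρ : ∀ x ∈ U, ρ x ≠ 0) {t : ℝ} (ht : t ∈ times U) :
    HasDerivAt (aTime ε R b) (deriv R t * slope R (aTime ε R b) t) t := by
  have h := smooth_hasDerivAt (hS.smooth_aTime hρ) (isOpen_times hS.isOpen) ht
  rwa [slope, mul_div_cancel₀ _ (hS.expansion t ht)]

/-- The energy density obeys `Ṙ⁻¹ R ρ̇ = -3 a ρ`. -/
theorem hasDerivAt_density (hρ : ∀ x ∈ U, ρ x ≠ 0) {t : ℝ} (ht : t ∈ times U) :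
    HasDerivAt (friedmann ε R b)
      (-3 * (deriv R t / R t) * aTime ε R b t * friedmann ε R b t) t := by
  have h := smooth_hasDerivAt hS.smooth_density (isOpen_times hS.isOpen) ht
  have h1 := hS.expansion t ht
  have h2 := hS.R_ne t ht
  have h3 := hS.ne_zero_friedmann hρ ht
  convert h using 1
  rw [aTime, slope]
  field_simp

theorem aFun_eq {x : Event} (hx : x ∈ U) : aFun R ρ x = aTime ε R b (x 0) := by
  have h := smooth_hasDerivAt hS.smooth_density (isOpen_times hS.isOpen) (mem_times hx)
  rw [aFun, aTime, dR_eq_slope (F := friedmann ε R b) _ h.differentiableAt, hS.density_eq hx]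
  filter_upwards [hS.isOpen.mem_nhds hx] with y hy using hS.density_eq hy

theorem dR_aFun (hρ : ∀ x ∈ U, ρ x ≠ 0) {x : Event} (hx : x ∈ U) :
    dR R (aFun R ρ) x = slope R (aTime ε R b) (x 0) :=
  dR_eq_slope (by filter_upwards [hS.isOpen.mem_nhds hx] with y hy using hS.aFun_eq hy)
    (hS.hasDerivAt_aTime hρ (mem_times hx)).differentiableAt

theorem dR_b {x : Event} (hx : x ∈ U) : dR R (ofTime b) x = slope R b (x 0) :=
  dR_eq_slope (Filter.Eventually.of_forall fun _ => rfl)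
    (hS.hasDerivAt_b (mem_times hx)).differentiableAt

theorem dR_dR_b {x : Event} (hx : x ∈ U) :
    dR R (dR R (ofTime b)) x = slope R (slope R b) (x 0) :=
  dR_eq_slope (by filter_upwards [hS.isOpen.mem_nhds hx] with y hy using hS.dR_b hy)
    (hS.hasDerivAt_slope (mem_times hx)).differentiableAt

theorem hasGrad_density (hρ : ∀ x ∈ U, ρ x ≠ 0) {x : Event} (hx : x ∈ U) :
    HasGrad ρ (fun μ => if μ = 0 then
      -3 * (deriv R (x 0) / R (x 0)) * aTime ε R b (x 0) * friedmann ε R b (x 0) else 0) x :=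
  (hasGrad_time (hS.hasDerivAt_density hρ (mem_times hx))).congr
    (by filter_upwards [hS.isOpen.mem_nhds hx] with y hy using hS.density_eq hy)

theorem pressure_ratio (hρ : ∀ x ∈ U, ρ x ≠ 0) {x : Event} (hx : x ∈ U) :
    p x / ρ x = aTime ε R b (x 0) / lapse ε R b x - 1 := by
  have h := hρ x hx
  rw [hS.density_eq hx] at h
  rw [hS.pressure_eq hρ hx, hS.density_eq hx]
  field_simp

theorem hasGrad_ratio (hρ : ∀ x ∈ U, ρ x ≠ 0) {x : Event} (hx : x ∈ U) :
    HasGrad (fun y => p y / ρ y) (fun μ =>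
      ((if μ = 0 then deriv R (x 0) * slope R (aTime ε R b) (x 0) else 0)
        - aTime ε R b (x 0) * lapseLog ε R b μ x) / lapse ε R b x) x := by
  have h0 := hS.lapse_ne x hx
  refine ((((hasGrad_time (hS.hasDerivAt_aTime hρ (mem_times hx))).div
    (hS.isoMetric.hasGrad_lapse x hx) h0).sub (hasGrad_const 1 x)).congr
    (by filter_upwards [hS.isOpen.mem_nhds hx] with y hy using hS.pressure_ratio hρ hy)).of_eq
    fun μ => ?_
  split_ifs <;> field_simp <;> ring

theorem hasGrad_pressure (hρ : ∀ x ∈ U, ρ x ≠ 0) {x : Event} (hx : x ∈ U) :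
    HasGrad p (fun μ => pd μ ρ x * (p x / ρ x) + ρ x * pd μ (fun y => p y / ρ y) x) x := by
  have h := (hasGrad_of_differentiableAt (hS.hasGrad_density hρ hx).1).mul
    (hasGrad_of_differentiableAt (hS.hasGrad_ratio hρ hx).1)
  refine h.congr ?_
  filter_upwards [hS.isOpen.mem_nhds hx] with y hy
  rw [mul_div_cancel₀ _ (hρ y hy)]

/-- A universe with `a b' = 0` at all times is barotropic. -/
theorem exists_regular_time (hρ : ∀ x ∈ U, ρ x ≠ 0) :
    ∃ t ∈ times U, aTime ε R b t ≠ 0 ∧ slope R b t ≠ 0 := by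
  by_contra! hcon
  refine hS.not_barotropic fun x hx => ?_
  have hρx := (hS.hasGrad_density hρ hx).2
  have key : ∀ i : Fin 4, i ≠ 0 → pd i p x * pd 0 ρ x = 0 := by
    intro i hi
    by_cases ha : aTime ε R b (x 0) = 0
    · simp [hρx, ha]
    · have hb := hcon _ (mem_times hx) ha
      simp only [(hS.hasGrad_pressure hρ hx).2 i, (hS.hasGrad_ratio hρ hx).2 i, hρx i,
        lapseLog_spatial hb hi]
      simp [hi]
  have hi0 : ∀ i : Fin 4, i ≠ 0 → pd i ρ x = 0 := fun i hi => by simp [hρx, hi]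
  intro μ ν
  by_cases hμ : μ = 0 <;> by_cases hν : ν = 0
  · simp [hμ, hν]
  · subst hμ
    rw [hi0 ν hν, key ν hν]
    simp
  · subst hν
    rw [hi0 μ hμ, key μ hμ]
    simp
  · simp [hi0 μ hμ, hi0 ν hν]

/-- The Einstein equations imply the conservation of energy and momentum. -/
theorem conservation (hρ : ∀ x ∈ U, ρ x ≠ 0) {x : Event} (hx : x ∈ U) (ν : Fin 4) :
    divTensor (metric ε R b) (energyTensor (metric ε R b) (velocity ε R b) ρ p) ν x = 0 := by
  have h0 := hS.lapse_ne x hx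
  have h1 := hS.R_ne _ (mem_times hx)
  have h2 : ρ x ≠ 0 := hρ x hx
  have hp : ρ x + p x = ρ x * (aTime ε R b (x 0) / lapse ε R b x) := by
    have := hS.pressure_ratio hρ hx
    field_simp at this ⊢
    linear_combination this
  refine (hS.isoMetric.divTensor_eq hx (hS.hasGrad_density hρ hx).1
    (hS.hasGrad_pressure hρ hx).1 ν).trans ?_
  split_ifs with hν
  · rw [hp]
    simp only [(hS.hasGrad_density hρ hx).2 0, hS.scaleLog_zero hx, hS.density_eq hx, if_true]
    field_simp
    ring
  · simp only [hp, (hS.hasGrad_pressure hρ hx).2, (hS.hasGrad_ratio hρ hx).2,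
      (hS.hasGrad_density hρ hx).2 ν, if_neg hν]
    field_simp
    ring

/-- Conservation of matter: the matter density decays like `Ω⁻³`. -/
theorem matter_iff {r : Event → ℝ} {x : Event} (hx : x ∈ U) (hr : DifferentiableAt ℝ r x) :
    divVec (metric ε R b) (fun μ y => r y * velocity ε R b μ y) x = 0 ↔
      pd 0 r x = -3 * (lapse ε R b x * (deriv R (x 0) / R (x 0))) * r x := by
  have h0 := hS.lapse_ne x hx
  have h := hS.isoMetric.divVec_eq hx hr
  rw [hS.scaleLog_zero hx] at h
  rw [show divVec (metric ε R b) (fun μ y => r y * velocity ε R b μ y) x = _ from h,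
    div_eq_zero_iff, or_iff_left h0]
  constructor <;> intro h <;> linear_combination h

end ThermodynamicStephani

/-- The Duhem-Gibbs relation for an ideal gas, in terms of the matter density and the entropy. -/
theorem gibbs_iff {r T s ie : Event → ℝ} {x : Event} {k : ℝ} (hk : k ≠ 0)
    (hr : DifferentiableAt ℝ r x) (hρ : DifferentiableAt ℝ ρ x)
    (hr0 : r x ≠ 0) (hie : ie =ᶠ[𝓝 x] fun y => ρ y / r y - 1) (hT : p x = k * r x * T x) :
    T x • fderiv ℝ s x = fderiv ℝ ie x + p x • fderiv ℝ (fun y => 1 / r y) x ↔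
      ∀ μ, p x * pd μ s x = k * (pd μ ρ x - (ρ x + p x) * pd μ r x / r x) := by
  have h1 := (((hasGrad_of_differentiableAt hρ).div (hasGrad_of_differentiableAt hr) hr0).sub
    (hasGrad_const 1 x)).congr hie
  have h2 := (hasGrad_const 1 x).div (hasGrad_of_differentiableAt hr) hr0
  have key : ∀ μ, (pd μ ie x + p x * pd μ (fun y => 1 / r y) x) * (k * r x)
      = k * (pd μ ρ x - (ρ x + p x) * pd μ r x / r x) := by
    intro μ
    rw [h1.2, h2.2]
    field_simp
    ring
  have hkr : k * r x ≠ 0 := mul_ne_zero hk hr0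
  constructor
  · intro h μ
    have h3 := congrArg (fun A : Event →L[ℝ] ℝ => A (Pi.single μ 1)) h
    have h4 : T x * pd μ s x = pd μ ie x + p x * pd μ (fun y => 1 / r y) x := h3
    rw [← key μ, ← h4, hT]
    ring
  · intro h
    have h5 : ∀ μ, T x * pd μ s x = pd μ ie x + p x * pd μ (fun y => 1 / r y) x := by
      intro μ
      have := h μ
      rw [← key μ] at this
      refine mul_right_cancel₀ hkr ?_
      linear_combination this - pd μ s x * hT
    refine ContinuousLinearMap.coe_injective ((Pi.basisFun ℝ (Fin 4)).ext fun μ => ?_)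
    simpa [pd] using h5 μ

end

/-! ### Ideal gases along a world line -/

section

variable {ε : ℝ} {R b : ℝ → ℝ} {ρ p : Event → ℝ} {U : Set Event}

theorem add_time_apply (x : Event) (τ : ℝ) {i : Fin 4} (hi : i ≠ 0) :
    (x + Pi.single 0 τ : Event) i = x i := by simp [hi]

theorem apply_add_time {f : Event → ℝ} {x y : Event} {δ : ℝ}
    (hf : ∀ y ∈ Metric.ball x δ, DifferentiableAt ℝ f y ∧ pd 0 f y = 0) {τ : ℝ}
    (hτ : |τ| < δ / 2) (hy : y ∈ Metric.ball x (δ / 2)) : f (y + Pi.single 0 τ) = f y := by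
  have hδ : 0 < δ / 2 := (abs_nonneg τ).trans_lt hτ
  have hmem : ∀ σ ∈ Metric.ball (0 : ℝ) (δ / 2),
      (y + Pi.single 0 σ : Event) ∈ Metric.ball x δ := by
    intro σ hσ
    rw [mem_ball_zero_iff] at hσ
    have h1 : ‖(Pi.single 0 σ : Event)‖ = ‖σ‖ := Pi.norm_single ..
    have h2 : dist (y + Pi.single 0 σ : Event) x ≤ dist y x + ‖(Pi.single 0 σ : Event)‖ := by
      rw [dist_eq_norm, dist_eq_norm]
      calc ‖y + Pi.single 0 σ - x‖ = ‖(y - x) + Pi.single 0 σ‖ := by congr 1; abel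
        _ ≤ _ := norm_add_le _ _
    rw [Metric.mem_ball] at hy ⊢
    linarith
  have hder : ∀ σ ∈ Metric.ball (0 : ℝ) (δ / 2),
      HasDerivAt (fun σ : ℝ => f (y + Pi.single 0 σ)) 0 σ := by
    intro σ hσ
    obtain ⟨h1, h2⟩ := hf _ (hmem σ hσ)
    have h3 : HasDerivAt (fun σ : ℝ => (y + Pi.single 0 σ : Event)) (Pi.single 0 1) σ := by
      rw [hasDerivAt_pi]
      intro j
      by_cases hj : j = 0
      · subst hj
        simpa using (hasDerivAt_id σ).const_add (y 0)
      · simpa [hj] using hasDerivAt_const σ (y j)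
    rw [← h2]
    exact h1.hasFDerivAt.comp_hasDerivAt σ h3
  simpa using Metric.isOpen_ball.is_const_of_deriv_eq_zero
    (convex_ball (0 : ℝ) (δ / 2)).isPreconnected
    (fun σ hσ => (hder σ hσ).differentiableAt.differentiableWithinAt)
    (fun σ hσ => (hder σ hσ).deriv) (show τ ∈ _ by simpa using hτ) (Metric.mem_ball_self hδ)

/-- The spatial gradient of a function that is constant in time is constant in time. -/
theorem pd_add_time {f : Event → ℝ} {x : Event} {δ : ℝ}
    (hf : ∀ y ∈ Metric.ball x δ, DifferentiableAt ℝ f y ∧ pd 0 f y = 0) {τ : ℝ}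
    (hτ : |τ| < δ / 2) (i : Fin 4) : pd i f (x + Pi.single 0 τ) = pd i f x := by
  have hδ : 0 < δ / 2 := (abs_nonneg τ).trans_lt hτ
  have he : (fun y => f (y + Pi.single 0 τ)) =ᶠ[𝓝 x] f := by
    filter_upwards [Metric.ball_mem_nhds x hδ] with y hy using apply_add_time hf hτ hy
  rw [pd, pd, ← he.fderiv_eq, fderiv_comp_add_right]

/-- The Duhem-Gibbs relation and the conservation of matter for an ideal gas at rest. In
particular, the entropy is constant along the world lines where the pressure does not vanish. -/
theorem ThermodynamicStephani.thermodynamic_evolution (hS : ThermodynamicStephani ε R b ρ p U)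
    (hρ : ∀ x ∈ U, ρ x ≠ 0) {k : ℝ} (hk : 0 < k) {V : Set Event} (hV : IsOpen V) (hVU : V ⊆ U)
    {r ie T s : Event → ℝ}
    (hL : LocalThermalEquilibrium (metric ε R b) (velocity ε R b) ρ p V r ie T s)
    (hT : ∀ x ∈ V, p x = k * r x * T x) {x : Event} (hx : x ∈ V) :
    (∀ μ, p x * pd μ s x = k * (pd μ ρ x - (ρ x + p x) * pd μ r x / r x)) ∧
    pd 0 r x = -3 * (lapse ε R b x * (deriv R (x 0) / R (x 0))) * r x ∧
    p x * pd 0 s x = 0 := by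
  have hxU := hVU hx
  have hr0 := (hL.r_pos x hx).ne'
  have hr : DifferentiableAt ℝ r x :=
    (hL.smooth_r.contDiffAt (hV.mem_nhds hx)).differentiableAt (by simp)
  have hg := (gibbs_iff hk.ne' hr (hS.hasGrad_density hρ hxU).1 hr0 (by
    filter_upwards [hV.mem_nhds hx] with y hy
    have h1 := hL.energy_decomposition y hy
    have h2 := (hL.r_pos y hy).ne'
    rw [h1]
    field_simp
    ring) (hT x hx)).1 (hL.duhem_gibbs x hx)
  have hm := (hS.matter_iff hxU hr).1 (hL.matter_conservation x hx)
  refine ⟨hg, hm, ?_⟩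
  have h0 := hS.lapse_ne x hxU
  have h1 := hS.R_ne _ (mem_times hxU)
  have h2 := hρ x hxU
  have hp : p x = ρ x * (aTime ε R b (x 0) / lapse ε R b x - 1) := by
    rw [← hS.pressure_ratio hρ hxU]
    field_simp
  rw [hg 0, hm, hp]
  simp only [(hS.hasGrad_density hρ hxU).2 0, if_true, ← hS.density_eq hxU]
  field_simp
  ring

/-- In the equilibrium evolution of an ideal gas, conservation of matter and entropy makes
`(1 + P w) / a` an affine function of `b` along each world line. -/
theorem ThermodynamicStephani.affine_along (hS : ThermodynamicStephani ε R b ρ p U)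
    (hρ : ∀ x ∈ U, ρ x ≠ 0) {k : ℝ} (hk : 0 < k) {V : Set Event} (hV : IsOpen V) (hVU : V ⊆ U)
    {r ie T s : Event → ℝ}
    (hL : LocalThermalEquilibrium (metric ε R b) (velocity ε R b) ρ p V r ie T s)
    (hT : ∀ x ∈ V, p x = k * r x * T x) {x : Event} (hx : x ∈ V) (hp : p x ≠ 0)
    (hc : conf ε x ≠ ε / 2 * x 3 ^ 2)
    (ha : aTime ε R b (x 0) ≠ 0) (hb : slope R b (x 0) ≠ 0) :
    ∃ E F : ℝ, ∀ᶠ t in 𝓝 (x 0), (1 + shifted R b t * wCoord ε x) / aTime ε R b t = E + F * b t := by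
  have hxU := hVU hx
  have hc0 := hS.conf_ne x hxU
  -- a box around `x` on which `p` does not vanish
  have hpc : ContinuousAt p x := (hS.hasGrad_pressure hρ hxU).1.continuousAt
  obtain ⟨δ, hδ, hball⟩ := Metric.mem_nhds_iff.1
    (Filter.inter_mem (hV.mem_nhds hx) (hpc.eventually_ne hp))
  -- `m = r Ω³` is constant along the world line
  set m : Event → ℝ := fun y => r y * omega ε R b y ^ 3 with hm
  have hmg : ∀ y ∈ V, HasGrad m (fun μ => m y * (pd μ r y / r y + 3 * scaleLog ε R b μ y)) y := by
    intro y hy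
    have hr0 := (hL.r_pos y hy).ne'
    have hr : DifferentiableAt ℝ r y :=
      (hL.smooth_r.contDiffAt (hV.mem_nhds hy)).differentiableAt (by simp)
    have h3 : HasDerivAt (fun s : ℝ => s ^ 3) (3 * omega ε R b y ^ 2) (omega ε R b y) := by
      simpa using hasDerivAt_pow 3 (omega ε R b y)
    refine ((hasGrad_of_differentiableAt hr).mul
      ((hS.isoMetric.hasGrad_scale y (hVU hy)).comp h3)).of_eq fun μ => ?_
    simp only [hm]
    field_simp
  have hsd : ∀ y ∈ Metric.ball x δ, DifferentiableAt ℝ s y ∧ pd 0 s y = 0 := by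
    intro y hy
    obtain ⟨hyV, hyp⟩ := hball hy
    exact ⟨(hL.smooth_s.contDiffAt (hV.mem_nhds hyV)).differentiableAt (by simp),
      (mul_eq_zero.1 (hS.thermodynamic_evolution hρ hk hV hVU hL hT hyV).2.2).resolve_left hyp⟩
  have hmd : ∀ y ∈ Metric.ball x δ, DifferentiableAt ℝ m y ∧ pd 0 m y = 0 := by
    intro y hy
    obtain ⟨hyV, hyp⟩ := hball hy
    have hr0 := (hL.r_pos y hyV).ne'
    refine ⟨(hmg y hyV).1, ((hmg y hyV).2 0).trans ?_⟩
    beta_reduce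
    rw [(hS.thermodynamic_evolution hρ hk hV hVU hL hT hyV).2.1, hS.scaleLog_zero (hVU hyV)]
    field_simp
    ring
  set S : ℝ := pd 3 s x with hSdef
  set Q : ℝ := pd 3 m x / m x with hQdef
  -- the spatial part of the Duhem-Gibbs relation at the nearby events of the world line
  have hrel : ∀ᶠ t in 𝓝 (x 0), aTime ε R b t ≠ 0 ∧
      (conf ε x + 2 * shifted R b t * x 3) / aTime ε R b t * S
        = (conf ε x * (S + k * Q) + 3 * k * (ε / 2 * x 3))
          + (2 * x 3 * (S + k * Q) + 6 * k) * b t := by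
    have hat : ∀ᶠ t in 𝓝 (x 0), aTime ε R b t ≠ 0 :=
      (hS.hasDerivAt_aTime hρ (mem_times hxU)).continuousAt.eventually_ne ha
    filter_upwards [hat, Metric.ball_mem_nhds (x 0) (half_pos hδ)] with t hta htb
    refine ⟨hta, ?_⟩
    have hτ : |t - x 0| < δ / 2 := by simpa [Real.dist_eq] using htb
    set y : Event := x + Pi.single 0 (t - x 0) with hy
    have hy0 : y 0 = t := by simp [hy]
    have hyi : ∀ i : Fin 4, i ≠ 0 → y i = x i := fun i hi => add_time_apply x _ hi
    have hyb : y ∈ Metric.ball x δ := by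
      rw [Metric.mem_ball, dist_eq_norm, hy, add_sub_cancel_left, Pi.norm_single]
      rw [Real.norm_eq_abs]
      linarith
    obtain ⟨hyV, -⟩ := hball hyb
    have hyU := hVU hyV
    have h1 : pd 3 s y = S := pd_add_time hsd hτ 3
    have h2 : pd 3 m y = pd 3 m x := pd_add_time hmd hτ 3
    have h3 : m y = m x := apply_add_time hmd hτ (Metric.mem_ball_self (half_pos hδ))
    have hr0 := (hL.r_pos y hyV).ne'
    have hm0 : m y ≠ 0 := mul_ne_zero hr0 (pow_ne_zero 3 (hS.isoMetric.scale_ne y hyU))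
    have h4 : pd 3 r y / r y = Q - 3 * scaleLog ε R b 3 y := by
      have h5 := (hmg y hyV).2 3
      rw [h2] at h5
      rw [hQdef, ← h3, h5]
      field_simp
      ring
    have hconf : conf ε y = conf ε x := by
      simp only [conf, hyi 1 (by decide), hyi 2 (by decide), hyi 3 (by decide)]
    have hq : ∀ β : ℝ → ℝ, quad ε β y = conf ε x + 2 * β t * x 3 := fun β => by
      rw [quad, hconf, hy0, hyi 3 (by decide)]
    have hsl : scaleLog ε R b 3 y
        = -(ε / 2 * x 3 + 2 * b t) / (conf ε x + 2 * b t * x 3) := by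
      simp only [scaleLog, hq, quadGrad, Matrix.cons_val, hy0, hyi 3 (by decide), Fin.reduceEq,
        if_false]
      ring
    have hg := (hS.thermodynamic_evolution hρ hk hV hVU hL hT hyV).1 3
    have hp : p y = ρ y * (aTime ε R b t / lapse ε R b y - 1) := by
      rw [← hy0, ← hS.pressure_ratio hρ hyU, mul_div_cancel₀ _ (hρ y hyU)]
    have h6 := hρ y hyU
    have h7 := hS.quad_ne hyU
    have h8 := hS.quad_shifted_ne hyU
    rw [mul_div_assoc, h4, hsl, h1, hp, hS.lapse_eq hyU] at hg
    simp only [(hS.hasGrad_density hρ hyU).2 3, Fin.reduceEq, if_false] at hg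
    rw [hq] at h7 h8 hg
    rw [hq] at hg
    obtain ⟨N, hN⟩ : ∃ N, conf ε x + 2 * b t * x 3 = N := ⟨_, rfl⟩
    rw [hN] at h7 hg
    field_simp at hg ⊢
    refine mul_left_cancel₀ (mul_ne_zero h6 h7) ?_
    linear_combination -hg - 2 * ρ y * N * aTime ε R b t * (S + k * Q) * hN
  -- otherwise the right-hand side vanishes although `b` is not constant, hence `∂_z w = 0`
  have hS0 : S ≠ 0 := by
    intro h0
    have hev : ∀ᶠ t in 𝓝 (x 0), (conf ε x * (k * Q) + 3 * k * (ε / 2 * x 3))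
          + (2 * x 3 * (k * Q) + 6 * k) * b t = 0 := by
      filter_upwards [hrel] with t ht
      have := ht.2
      rw [h0] at this
      linear_combination -this
    have hd := ((hS.hasDerivAt_b (mem_times hxU)).const_mul (2 * x 3 * (k * Q) + 6 * k)).const_add
      (conf ε x * (k * Q) + 3 * k * (ε / 2 * x 3))
    have hz : (2 * x 3 * (k * Q) + 6 * k) * (deriv R (x 0) * slope R b (x 0)) = 0 := by
      rw [← hd.deriv, Filter.EventuallyEq.deriv_eq hev]
      simp
    have h1 : 2 * x 3 * (k * Q) + 6 * k = 0 := by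
      have := hS.expansion _ (mem_times hxU)
      simpa [this, hb] using hz
    have h2 := hev.self_of_nhds
    rw [h1] at h2
    refine hc ?_
    have h3 : k * (conf ε x - ε / 2 * x 3 ^ 2) = 0 := by
      linear_combination conf ε x * h1 / 6 - x 3 / 3 * h2
    linarith [(mul_eq_zero.1 h3).resolve_left hk.ne']
  refine ⟨(conf ε x * (S + k * Q) + 3 * k * (ε / 2 * x 3)) / S / conf ε x,
    (2 * x 3 * (S + k * Q) + 6 * k) / S / conf ε x, ?_⟩
  filter_upwards [hrel] with t ht
  obtain ⟨hta, ht⟩ := ht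
  rw [wCoord]
  field_simp at ht ⊢
  linear_combination ht

end

section

/-! ### Real analysis -/

/-- A continuous function on an open subset of the line has an antiderivative there. -/
theorem exists_antiderivative {O : Set ℝ} (hO : IsOpen O) {f : ℝ → ℝ} (hf : ContinuousOn f O) :
    ∃ F : ℝ → ℝ, ∀ x ∈ O, HasDerivAt F (f x) x := by
  classical
  -- a base point in each connected component
  let base : Set ℝ → ℝ := fun C => if h : C.Nonempty then h.some else 0
  refine ⟨fun x => ∫ u in (base (connectedComponentIn O x))..x, f u, fun x hx => ?_⟩
  set C := connectedComponentIn O x with hC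
  have hCo : IsOpen C := hO.connectedComponentIn
  have hxC : x ∈ C := mem_connectedComponentIn hx
  have hbC : base C ∈ C := by
    have hne : C.Nonempty := ⟨x, hxC⟩
    simp only [base, dif_pos hne]
    exact hne.some_mem
  have hCO : C ⊆ O := connectedComponentIn_subset O x
  have hsub : Set.uIcc (base C) x ⊆ C :=
    isPreconnected_connectedComponentIn.ordConnected.uIcc_subset hbC hxC
  have hd : HasDerivAt (fun y => ∫ u in (base C)..y, f u) (f x) x :=
    intervalIntegral.integral_hasDerivAt_right
      ((hf.mono (hsub.trans hCO)).intervalIntegrable)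
      (hf.stronglyMeasurableAtFilter hO x hx) (hf.continuousAt (hO.mem_nhds hx))
  refine hd.congr_of_eventuallyEq ?_
  filter_upwards [hCo.mem_nhds hxC] with y hy
  rw [← connectedComponentIn_eq hy]

/-- A solution of a linear equation `y' = K y` that is not zero at one point of an interval has no
zero. The equation needs to hold only where the condition `G` does, provided that near the points
with `y ≠ 0` the condition holds either everywhere or nowhere. -/
theorem ne_zero_of_linear_ode {I : Set ℝ} (hI : IsOpen I) (hIc : IsPreconnected I)
    {y K : ℝ → ℝ} (hK : ContinuousOn K I) (hy : ContinuousOn y I) {G : ℝ → Prop}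
    (hd : ∀ t ∈ I, G t → HasDerivAt y (K t * y t) t)
    (hG : ∀ t ∈ I, y t ≠ 0 → (∃ᶠ s in 𝓝 t, G s) → ∀ᶠ s in 𝓝 t, G s)
    {t₀ : ℝ} (ht₀ : t₀ ∈ I) (hy₀ : y t₀ ≠ 0) (hG₀ : ∃ᶠ s in 𝓝 t₀, G s) :
    ∀ t ∈ I, G t ∧ y t ≠ 0 := by
  obtain ⟨Φ, hΦ⟩ := exists_antiderivative hI hK
  set z : ℝ → ℝ := fun t => y t * Real.exp (-Φ t) with hz
  have hzc : ContinuousOn z I := hy.mul fun t ht =>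
    ((hΦ t ht).neg.exp.continuousAt).continuousWithinAt
  have hzne : z t₀ ≠ 0 := mul_ne_zero hy₀ (Real.exp_ne_zero _)
  have hyz : ∀ t, z t = z t₀ → y t ≠ 0 := fun t h h0 => hzne (by rw [← h, hz]; simp [h0])
  -- the set on which `y exp(-Φ)` keeps its initial value is open and closed in `I`
  set Z : Set ℝ := {t | t ∈ I ∧ (∀ᶠ s in 𝓝 t, G s) ∧ z t = z t₀} with hZ
  have hZo : IsOpen Z := by
    rw [isOpen_iff_mem_nhds]
    rintro t ⟨ht, hGt, hzt⟩
    obtain ⟨δ, hδ, hball⟩ := Metric.mem_nhds_iff.1 (Filter.inter_mem (hI.mem_nhds ht) hGt)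
    refine Filter.mem_of_superset (Metric.ball_mem_nhds t hδ) fun s hs => ?_
    refine ⟨(hball hs).1, Filter.mem_of_superset (Metric.isOpen_ball.mem_nhds hs)
      fun u hu => (hball hu).2, ?_⟩
    have hder : ∀ u ∈ Metric.ball t δ, HasDerivAt z 0 u := by
      intro u hu
      obtain ⟨huI, huG⟩ := hball hu
      have h1 := (hd u huI huG).mul (hΦ u huI).neg.exp
      have h2 : K u * y u * Real.exp (-Φ u) + y u * (Real.exp (-Φ u) * -K u) = 0 := by ring
      rw [show (-Φ) u = -Φ u from rfl, h2] at h1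
      exact h1
    rw [← hzt]
    exact Metric.isOpen_ball.is_const_of_deriv_eq_zero (convex_ball t δ).isPreconnected
      (fun u hu => (hder u hu).differentiableAt.differentiableWithinAt)
      (fun u hu => (hder u hu).deriv) hs (Metric.mem_ball_self hδ)
  have hsub : I ⊆ Z := by
    refine hIc.subset_of_closure_inter_subset hZo ⟨t₀, ht₀, ht₀, hG t₀ ht₀ hy₀ hG₀, rfl⟩ ?_
    rintro t ⟨htc, ht⟩
    have hfr : ∃ᶠ s in 𝓝 t, s ∈ Z := mem_closure_iff_frequently.1 htc
    have hzt : z t = z t₀ := by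
      by_contra hne
      obtain ⟨s, hs1, hs2⟩ := (hfr.and_eventually
        ((hzc.continuousAt (hI.mem_nhds ht)).eventually_ne hne)).exists
      exact hs2 hs1.2.2
    exact ⟨ht, hG t ht (hyz t hzt) (hfr.mono fun s hs => hs.2.1.self_of_nhds), hzt⟩
  exact fun t ht => ⟨(hsub ht).2.1.self_of_nhds, hyz t (hsub ht).2.2⟩

theorem finite_quadratic_zeros {A B C : ℝ} (h : A ≠ 0 ∨ B ≠ 0 ∨ C ≠ 0) :
    {w : ℝ | A + B * w + C * w ^ 2 = 0}.Finite := by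
  set q : Polynomial ℝ := Polynomial.C A + Polynomial.C B * Polynomial.X
    + Polynomial.C C * Polynomial.X ^ 2 with hq
  have hq0 : q ≠ 0 := by
    intro h0
    have h1 := congrArg (Polynomial.coeff · 0) h0
    have h2 := congrArg (Polynomial.coeff · 1) h0
    have h3 := congrArg (Polynomial.coeff · 2) h0
    simp [hq, Polynomial.coeff_X, Polynomial.coeff_C] at h1 h2 h3
    simp_all
  refine (Polynomial.finite_setOfPred_isRoot hq0).subset fun w hw => ?_
  simpa [hq, Polynomial.IsRoot] using hw

/-! ### Simultaneous events -/

variable {ε : ℝ} {R b : ℝ → ℝ} {ρ p : Event → ℝ} {U : Set Event}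

/-- Near each event there are simultaneous events at which `w` avoids finitely many values and
`∂_z w ≠ 0`. -/
theorem exists_generic_event (hU : IsOpen U) (hc : ∀ x ∈ U, conf ε x ≠ 0) {x : Event} (hx : x ∈ U)
    {F : Set ℝ} (hF : F.Finite) :
    ∃ y ∈ U, y 0 = x 0 ∧ conf ε y ≠ ε / 2 * y 3 ^ 2 ∧ wCoord ε y ∉ F := by
  set l : ℝ → Event := fun z => Function.update x 3 z with hl
  have hlc : Continuous l := continuous_const.update 3 continuous_id
  have hl3 : l (x 3) = x := Function.update_eq_self 3 x
  have hmem : l ⁻¹' U ∈ 𝓝 (x 3) := hlc.continuousAt.preimage_mem_nhds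
    (by rw [hl3]; exact hU.mem_nhds hx)
  set c := 1 + ε / 4 * (x 1 ^ 2 + x 2 ^ 2) with hcdef
  have hconf : ∀ z, conf ε (l z) = c + ε / 4 * z ^ 2 := by
    intro z
    simp [conf, hl, hcdef]
    ring
  -- the zeros of `∂_z w`
  have hbad1 : {z : ℝ | c + 0 * z + -(ε / 4) * z ^ 2 = 0}.Finite := by
    refine finite_quadratic_zeros ?_
    by_cases hε : ε = 0
    · left
      simp [hcdef, hε]
    · right; right
      simpa using hε
  -- the events at which `w` takes a value in `F`
  have hbad2 : (⋃ w ∈ F, {z : ℝ | w * c + -2 * z + w * (ε / 4) * z ^ 2 = 0}).Finite :=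
    hF.biUnion fun w _ => finite_quadratic_zeros (Or.inr (Or.inl (by norm_num)))
  obtain ⟨z, hzU, hz⟩ := ((infinite_of_mem_nhds _ hmem).sdiff (hbad1.union hbad2)).nonempty
  refine ⟨l z, hzU, by simp [hl], fun h => hz (Or.inl ?_), fun h => hz (Or.inr ?_)⟩
  · rw [hconf] at h
    simp only [hl, Function.update_self] at h
    show c + 0 * z + -(ε / 4) * z ^ 2 = 0
    linear_combination h
  · refine Set.mem_biUnion h ?_
    have h1 := hc _ hzU
    have h2 : wCoord ε (l z) * conf ε (l z) = 2 * z := by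
      rw [wCoord, div_mul_cancel₀ _ h1]
      simp [hl]
    rw [hconf] at h2
    show wCoord ε (l z) * c + -2 * z + wCoord ε (l z) * (ε / 4) * z ^ 2 = 0
    linear_combination h2

theorem along_velocity {f : Event → ℝ} {x : Event} :
    along (velocity ε R b) f x = pd 0 f x / lapse ε R b x := by
  simp [along, velocity]
  ring

namespace ThermodynamicStephani

variable (hS : ThermodynamicStephani ε R b ρ p U)
include hS

theorem lapse_eq_w {x : Event} (hx : x ∈ U) :
    lapse ε R b x = (1 + shifted R b (x 0) * wCoord ε x) / (1 + b (x 0) * wCoord ε x) := by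
  have h1 := hS.conf_ne x hx
  have h2 := hS.quad_ne hx
  rw [hS.lapse_eq hx, hS.one_add_eq hx, hS.one_add_eq hx]
  field_simp

theorem shifted_w_ne {x : Event} (hx : x ∈ U) : 1 + shifted R b (x 0) * wCoord ε x ≠ 0 := by
  rw [hS.one_add_eq hx]
  exact div_ne_zero (hS.quad_shifted_ne hx) (hS.conf_ne x hx)

theorem shifted_ne {t : ℝ} (ht : t ∈ times U) (hb : slope R b t ≠ 0) : shifted R b t ≠ b t := by
  have h := hS.R_ne t ht
  simp [shifted, h, hb]

/-- Time derivative of `P = b - R b'`. -/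
theorem hasDerivAt_shifted {t : ℝ} (ht : t ∈ times U) :
    HasDerivAt (shifted R b) (-(R t * deriv R t * slope R (slope R b) t)) t := by
  exact ((hS.hasDerivAt_b ht).sub ((hS.hasDerivAt_R ht).mul (hS.hasDerivAt_slope ht))).congr_deriv
    (by ring)

theorem lapseLog_zero {x : Event} (hx : x ∈ U) :
    lapseLog ε R b 0 x = -(R (x 0) * deriv R (x 0) * slope R (slope R b) (x 0)) * wCoord ε x
        / (1 + shifted R b (x 0) * wCoord ε x)
      - deriv R (x 0) * slope R b (x 0) * wCoord ε x / (1 + b (x 0) * wCoord ε x) := by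
  have h1 := hS.conf_ne x hx
  have h2 := hS.quad_ne hx
  have h3 := hS.quad_shifted_ne hx
  rw [lapseLog, hS.one_add_eq hx, hS.one_add_eq hx, wCoord]
  simp only [quadGrad, Matrix.cons_val, (hS.hasDerivAt_shifted (mem_times hx)).deriv,
    (hS.hasDerivAt_b (mem_times hx)).deriv]
  field_simp

/-- At a time with `a b' ≠ 0`, all simultaneous events satisfy `u(p/ρ) ≠ 0` and `p ≠ 0`, except for
finitely many values of `w`. -/
theorem finite_exceptional (hρ : ∀ x ∈ U, ρ x ≠ 0) {t : ℝ} (ht : t ∈ times U)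
    (ha : aTime ε R b t ≠ 0) (hb : slope R b t ≠ 0) :
    ∃ F : Set ℝ, F.Finite ∧ ∀ x ∈ U, x 0 = t → wCoord ε x ∉ F →
      along (velocity ε R b) (fun y => p y / ρ y) x ≠ 0 ∧ p x ≠ 0 := by
  have hR := hS.R_ne t ht
  have hR' := hS.expansion t ht
  have hP := hS.shifted_ne ht hb
  set a := aTime ε R b t
  set P := shifted R b t with hPdef
  set Pt := -(R t * deriv R t * slope R (slope R b) t) with hPt
  set bt := deriv R t * slope R b t with hbt
  have hbt0 : bt ≠ 0 := mul_ne_zero hR' hb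
  set at' := deriv R t * slope R (aTime ε R b) t with hat
  -- the first quadratic is `u(p/ρ)` and the second is `p`, up to factors without zeros
  refine ⟨{w | at' + (at' * (P + b t) - a * (Pt - bt)) * w
      + (at' * P * b t - a * (Pt * b t - bt * P)) * w ^ 2 = 0} ∪
    {w | (a - 1) + (a * b t - P) * w + 0 * w ^ 2 = 0},
    (finite_quadratic_zeros ?_).union (finite_quadratic_zeros ?_), ?_⟩
  · by_contra! h
    obtain ⟨h1, h2, h3⟩ := h
    rw [h1] at h2 h3
    have h4 : Pt = bt := by
      have : a * (Pt - bt) = 0 := by linear_combination -h2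
      linarith [(mul_eq_zero.1 this).resolve_left ha]
    have h5 : a * bt * (b t - P) = 0 := by
      rw [h4] at h3
      linear_combination -h3
    exact mul_ne_zero (mul_ne_zero ha hbt0) (sub_ne_zero.2 hP.symm) h5
  · by_contra! h
    obtain ⟨h1, h2, -⟩ := h
    refine hP ?_
    rw [sub_eq_zero.1 h1] at h2
    linarith
  · intro x hx hxt hw
    have d1 := hS.denom_ne x hx
    have d2 := hS.shifted_w_ne hx
    have hl := hS.lapse_ne x hx
    rw [hxt] at d1 d2
    refine ⟨fun h0 => hw (Or.inl ?_), fun h0 => hw (Or.inr ?_)⟩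
    · rw [along_velocity, div_eq_zero_iff, or_iff_left hl, (hS.hasGrad_ratio hρ hx).2 0] at h0
      simp only [if_true] at h0
      rw [div_eq_zero_iff, or_iff_left hl, hS.lapseLog_zero hx, hxt] at h0
      rw [← hPt, ← hbt, ← hat, ← hPdef] at h0
      rw [← hPdef] at d2
      simp only [Set.mem_ofPred_eq]
      obtain ⟨D₁, hD₁⟩ : ∃ D, 1 + b t * wCoord ε x = D := ⟨_, rfl⟩
      obtain ⟨D₂, hD₂⟩ : ∃ D, 1 + P * wCoord ε x = D := ⟨_, rfl⟩
      rw [hD₁, hD₂] at h0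
      rw [hD₁] at d1
      rw [hD₂] at d2
      field_simp at h0
      rw [← hD₁, ← hD₂] at h0
      linear_combination h0
    · have h1 := hS.pressure_ratio hρ hx
      rw [h0, hS.lapse_eq_w hx, hxt] at h1
      field_simp at h1
      simp only [Set.mem_ofPred_eq]
      linear_combination -h1

end ThermodynamicStephani

end

/-! ### From an ideal gas to the equations for `a` and `b` -/

section

variable {ε : ℝ} {R b : ℝ → ℝ} {ρ p : Event → ℝ} {U : Set Event}

/-- The ideal gas equations for `a` and `b` at the time `t`. -/
def IdealGasEquations (ε : ℝ) (R b : ℝ → ℝ) (c₁ c₂ t : ℝ) : Prop :=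
  R t * slope R (aTime ε R b) t
      = -aTime ε R b t * (c₁ * aTime ε R b t ^ 2 + c₂ * aTime ε R b t + 1) ∧
    slope R (slope R b) t * R t = -c₁ * aTime ε R b t ^ 2 * slope R b t

theorem IdealGasEquations.unique {c₁ c₂ d₁ d₂ t : ℝ} (hc : IdealGasEquations ε R b c₁ c₂ t)
    (hd : IdealGasEquations ε R b d₁ d₂ t) (ha : aTime ε R b t ≠ 0) (hb : slope R b t ≠ 0) :
    c₁ = d₁ ∧ c₂ = d₂ := by
  have h1 : c₁ = d₁ := by
    have h : aTime ε R b t ^ 2 * slope R b t * (c₁ - d₁) = 0 := by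
      linear_combination hc.2 - hd.2
    exact sub_eq_zero.1 ((mul_eq_zero.1 h).resolve_left (mul_ne_zero (pow_ne_zero 2 ha) hb))
  subst h1
  have h : aTime ε R b t ^ 2 * (c₂ - d₂) = 0 := by linear_combination hc.1 - hd.1
  exact ⟨rfl, sub_eq_zero.1 ((mul_eq_zero.1 h).resolve_left (pow_ne_zero 2 ha))⟩

namespace ThermodynamicStephani

variable (hS : ThermodynamicStephani ε R b ρ p U)
include hS

theorem equations_iff (hρ : ∀ x ∈ U, ρ x ≠ 0) (c₁ c₂ : ℝ) :
    (∀ x ∈ U, R (x 0) * dR R (aFun R ρ) x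
            = -aFun R ρ x * (c₁ * aFun R ρ x ^ 2 + c₂ * aFun R ρ x + 1) ∧
        dR R (dR R (ofTime b)) x * R (x 0) = -c₁ * aFun R ρ x ^ 2 * dR R (ofTime b) x) ↔
      ∀ t ∈ times U, IdealGasEquations ε R b c₁ c₂ t := by
  have key : ∀ x ∈ U, (R (x 0) * dR R (aFun R ρ) x
            = -aFun R ρ x * (c₁ * aFun R ρ x ^ 2 + c₂ * aFun R ρ x + 1) ∧
        dR R (dR R (ofTime b)) x * R (x 0) = -c₁ * aFun R ρ x ^ 2 * dR R (ofTime b) x) ↔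
      IdealGasEquations ε R b c₁ c₂ (x 0) := by
    intro x hx
    rw [hS.dR_aFun hρ hx, hS.dR_dR_b hx, hS.dR_b hx, hS.aFun_eq hx, IdealGasEquations]
  constructor
  · rintro h _ ⟨x, hx, rfl⟩
    exact (key x hx).1 (h x hx)
  · exact fun h x hx => (key x hx).2 (h _ (mem_times hx))

/-- Comparing two world lines, both `1 / a` and `P / a` are affine functions of `b` near a time with
`a b' ≠ 0`. -/
theorem affine_of_represents (hρ : ∀ x ∈ U, ρ x ≠ 0) {k : ℝ} (hk : 0 < k)
    (hrep : RepresentsIdealGas k (metric ε R b) (velocity ε R b) ρ p U) {t : ℝ}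
    (ht : t ∈ times U) (ha : aTime ε R b t ≠ 0) (hb : slope R b t ≠ 0) :
    ∃ A₀ A₁ B₀ B₁ : ℝ, ∀ᶠ s in 𝓝 t, 1 / aTime ε R b s = A₀ + A₁ * b s ∧
      shifted R b s / aTime ε R b s = B₀ + B₁ * b s := by
  obtain ⟨V, hV, hVU, -, hVmem, r, ie, T, s, hL, hT⟩ := hrep
  obtain ⟨F, hF, hgood⟩ := hS.finite_exceptional hρ ht ha hb
  have hline : ∀ x ∈ U, x 0 = t → conf ε x ≠ ε / 2 * x 3 ^ 2 → wCoord ε x ∉ F →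
      ∃ E G : ℝ, ∀ᶠ s in 𝓝 t, (1 + shifted R b s * wCoord ε x) / aTime ε R b s = E + G * b s := by
    intro x hx hxt hc hw
    obtain ⟨h1, h2⟩ := hgood x hx hxt hw
    subst hxt
    exact hS.affine_along hρ hk hV hVU hL hT (hVmem x hx h1) h2 hc ha hb
  obtain ⟨x₀, hx₀, hx₀t⟩ := ht
  obtain ⟨x, hx, hxt, hxc, hxF⟩ := exists_generic_event hS.isOpen hS.conf_ne hx₀ hF
  obtain ⟨y, hy, hyt, hyc, hyF⟩ := exists_generic_event hS.isOpen hS.conf_ne hx₀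
    (hF.insert (wCoord ε x))
  rw [Set.mem_insert_iff, not_or] at hyF
  obtain ⟨E₁, G₁, h₁⟩ := hline x hx (hxt.trans hx₀t) hxc hxF
  obtain ⟨E₂, G₂, h₂⟩ := hline y hy (hyt.trans hx₀t) hyc hyF.2
  have hne : wCoord ε y - wCoord ε x ≠ 0 := sub_ne_zero.2 hyF.1
  refine ⟨(E₁ * wCoord ε y - E₂ * wCoord ε x) / (wCoord ε y - wCoord ε x),
    (G₁ * wCoord ε y - G₂ * wCoord ε x) / (wCoord ε y - wCoord ε x),
    (E₂ - E₁) / (wCoord ε y - wCoord ε x), (G₂ - G₁) / (wCoord ε y - wCoord ε x), ?_⟩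
  filter_upwards [h₁, h₂] with s hs₁ hs₂
  rw [add_div, mul_div_right_comm] at hs₁ hs₂
  generalize 1 / aTime ε R b s = u at *
  generalize shifted R b s / aTime ε R b s = v at *
  constructor
  · field_simp
    linear_combination wCoord ε y * hs₁ - wCoord ε x * hs₂
  · field_simp
    linear_combination hs₂ - hs₁

/-- If `1 / a` and `P / a` are affine functions of `b`, then `a` and `b` obey the ideal gas
equations. -/
theorem equations_of_affine (hρ : ∀ x ∈ U, ρ x ≠ 0) {t A₀ A₁ B₀ B₁ : ℝ} (ht : t ∈ times U)
    (ha : aTime ε R b t ≠ 0)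
    (h : ∀ᶠ s in 𝓝 t, 1 / aTime ε R b s = A₀ + A₁ * b s ∧
      shifted R b s / aTime ε R b s = B₀ + B₁ * b s) :
    IdealGasEquations ε R b (B₁ * A₀ - A₁ * B₀) (-(A₀ + B₁)) t := by
  have hR := hS.R_ne t ht
  have hR' := hS.expansion t ht
  have hac := (hS.hasDerivAt_aTime hρ ht).continuousAt.eventually_ne ha
  have h1 : ∀ᶠ s in 𝓝 t, aTime ε R b s * (A₀ + A₁ * b s) - 1 = 0 := by
    filter_upwards [h, hac] with s hs has
    rw [← hs.1]
    field_simp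
    ring
  have h2 : ∀ᶠ s in 𝓝 t, aTime ε R b s * (B₀ + B₁ * b s) - shifted R b s = 0 := by
    filter_upwards [h, hac] with s hs has
    rw [← hs.2]
    field_simp
    ring
  have d1 := ((hS.hasDerivAt_aTime hρ ht).mul
    (((hS.hasDerivAt_b ht).const_mul A₁).const_add A₀)).sub_const 1
  have d2 := ((hS.hasDerivAt_aTime hρ ht).mul
    (((hS.hasDerivAt_b ht).const_mul B₁).const_add B₀)).sub (hS.hasDerivAt_shifted ht)
  have e1 := d1.unique ((hasDerivAt_const t (0 : ℝ)).congr_of_eventuallyEq h1)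
  have e2 := d2.unique ((hasDerivAt_const t (0 : ℝ)).congr_of_eventuallyEq h2)
  have f1 := h1.self_of_nhds
  have f2 := h2.self_of_nhds
  have hP : shifted R b t = b t - R t * slope R b t := rfl
  rw [hP] at f2
  rw [IdealGasEquations]
  generalize aTime ε R b t = a at *
  generalize slope R (aTime ε R b) t = a' at *
  generalize slope R (slope R b) t = b'' at *
  generalize slope R b t = b' at *
  generalize b t = β at *
  have g1 : a' = -A₁ * b' * a ^ 2 := by
    refine mul_left_cancel₀ hR' ?_
    linear_combination a * e1 - deriv R t * a' * f1
  have g2 : R t * b'' = -(a' * (B₀ + B₁ * β) + a * B₁ * b') := by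
    refine mul_left_cancel₀ hR' ?_
    linear_combination e2
  constructor
  · linear_combination R t * g1 - A₁ * a ^ 2 * f2 + a * (B₁ * a - 1) * f1
  · linear_combination g2 - (B₀ + B₁ * β) * g1 + b' * a * B₁ * f1

/-- The ideal gas equations make `a b'` a solution of a linear equation, hence keep it away from
zero. -/
theorem regular_of_equations (hρ : ∀ x ∈ U, ρ x ≠ 0) {c₁ c₂ : ℝ}
    (hG : ∀ t ∈ times U, aTime ε R b t ≠ 0 → slope R b t ≠ 0 →
      (∃ᶠ s in 𝓝 t, IdealGasEquations ε R b c₁ c₂ s) →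
        ∀ᶠ s in 𝓝 t, IdealGasEquations ε R b c₁ c₂ s)
    {t₀ : ℝ} (ht₀ : t₀ ∈ times U) (ha₀ : aTime ε R b t₀ ≠ 0) (hb₀ : slope R b t₀ ≠ 0)
    (hG₀ : ∃ᶠ s in 𝓝 t₀, IdealGasEquations ε R b c₁ c₂ s) :
    ∀ t ∈ times U, IdealGasEquations ε R b c₁ c₂ t ∧ aTime ε R b t * slope R b t ≠ 0 := by
  have hac := fun t (ht : t ∈ times U) => (hS.hasDerivAt_aTime hρ ht).continuousAt
  have hbc := fun t (ht : t ∈ times U) => (hS.hasDerivAt_slope ht).continuousAt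
  refine ne_zero_of_linear_ode (isOpen_times hS.isOpen)
    (isPreconnected_times hS.isConnected.isPreconnected)
    (y := fun t => aTime ε R b t * slope R b t)
    (K := fun t => deriv R t / R t *
      (-(c₁ * aTime ε R b t ^ 2 + c₂ * aTime ε R b t + 1) - c₁ * aTime ε R b t ^ 2))
    ?_ ?_ ?_ (fun t ht hy => hG t ht (left_ne_zero_of_mul hy) (right_ne_zero_of_mul hy))
    ht₀ (mul_ne_zero ha₀ hb₀) hG₀
  · intro t ht
    have h1 := (hS.hasDerivAt_hubble ht).continuousAt
    have h2 := hac t ht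
    exact (h1.mul (((((h2.pow 2).const_mul c₁).add (h2.const_mul c₂)).add_const 1).neg.sub
      ((h2.pow 2).const_mul c₁))).continuousWithinAt
  · exact fun t ht => ((hac t ht).mul (hbc t ht)).continuousWithinAt
  · intro t ht hG
    have hR := hS.R_ne t ht
    refine ((hS.hasDerivAt_aTime hρ ht).mul (hS.hasDerivAt_slope ht)).congr_deriv ?_
    field_simp
    linear_combination deriv R t * slope R b t * hG.1 + deriv R t * aTime ε R b t * hG.2

/-- An ideal gas satisfies the ideal gas equations with the same constants at all times. -/
theorem equations_of_represents (hρ : ∀ x ∈ U, ρ x ≠ 0) {k : ℝ} (hk : 0 < k)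
    (hrep : RepresentsIdealGas k (metric ε R b) (velocity ε R b) ρ p U) :
    ∃ c₁ c₂ : ℝ, ∀ t ∈ times U, IdealGasEquations ε R b c₁ c₂ t := by
  have hI := isOpen_times hS.isOpen
  have hac := fun t (ht : t ∈ times U) => (hS.hasDerivAt_aTime hρ ht).continuousAt
  have hbc := fun t (ht : t ∈ times U) => (hS.hasDerivAt_slope ht).continuousAt
  have hloc : ∀ t ∈ times U, aTime ε R b t ≠ 0 → slope R b t ≠ 0 →
      ∃ c₁ c₂, ∀ᶠ s in 𝓝 t, IdealGasEquations ε R b c₁ c₂ s ∧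
        aTime ε R b s ≠ 0 ∧ slope R b s ≠ 0 := by
    intro t ht ha hb
    obtain ⟨A₀, A₁, B₀, B₁, h⟩ := hS.affine_of_represents hρ hk hrep ht ha hb
    refine ⟨B₁ * A₀ - A₁ * B₀, -(A₀ + B₁), ?_⟩
    filter_upwards [h.eventually_nhds, hI.mem_nhds ht, (hac t ht).eventually_ne ha,
      (hbc t ht).eventually_ne hb] with s hs hsI hsa hsb
    exact ⟨hS.equations_of_affine hρ hsI hsa hs, hsa, hsb⟩
  obtain ⟨t₀, ht₀, ha₀, hb₀⟩ := hS.exists_regular_time hρ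
  obtain ⟨c₁, c₂, h₀⟩ := hloc t₀ ht₀ ha₀ hb₀
  refine ⟨c₁, c₂, fun t ht => ?_⟩
  refine (hS.regular_of_equations hρ (fun t ht ha hb hfr => ?_) ht₀ ha₀ hb₀
    (h₀.mono fun s hs => hs.1).frequently t ht).1
  obtain ⟨d₁, d₂, hd⟩ := hloc t ht ha hb
  obtain ⟨s, hs, hs'⟩ := (hfr.and_eventually hd).exists
  obtain ⟨rfl, rfl⟩ := hs.unique hs'.1 hs'.2.1 hs'.2.2
  exact hd.mono fun s hs => hs.1

end ThermodynamicStephani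

end

/-! ### From the equations for `a` and `b` to an ideal gas -/

section

variable {ε : ℝ} {R b : ℝ → ℝ} {ρ p : Event → ℝ} {U : Set Event}

theorem contDiffOn_of_hasDerivAt {O : Set ℝ} (hO : IsOpen O) {F f : ℝ → ℝ}
    (hF : ∀ v ∈ O, HasDerivAt F (f v) v) (hf : ContDiffOn ℝ ∞ f O) : ContDiffOn ℝ ∞ F O := by
  rw [contDiffOn_infty_iff_deriv_of_isOpen hO]
  exact ⟨fun v hv => (hF v hv).differentiableAt.differentiableWithinAt,
    hf.congr fun v hv => (hF v hv).deriv⟩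

theorem contDiffOn_time {f : ℝ → ℝ} (hf : ContDiffOn ℝ ∞ f (times U)) :
    ContDiffOn ℝ ∞ (fun x : Event => f (x 0)) U :=
  hf.comp (contDiff_apply ℝ ℝ (0 : Fin 4)).contDiffOn fun _ hx => mem_times hx

theorem contDiffOn_quad {β : ℝ → ℝ} (hβ : ContDiffOn ℝ ∞ β (times U)) :
    ContDiffOn ℝ ∞ (quad ε β) U := by
  have hc : ContDiff ℝ ∞ (conf ε) := by
    unfold conf
    fun_prop
  exact hc.contDiffOn.add ((contDiffOn_const.mul (contDiffOn_time hβ)).mul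
    (contDiff_apply ℝ ℝ (3 : Fin 4)).contDiffOn)

namespace ThermodynamicStephani

variable (hS : ThermodynamicStephani ε R b ρ p U)
include hS

theorem contDiffOn_density : ContDiffOn ℝ ∞ ρ U :=
  (contDiffOn_time hS.smooth_density).congr fun _ hx => hS.density_eq hx

theorem contDiffOn_ratio (hρ : ∀ x ∈ U, ρ x ≠ 0) : ContDiffOn ℝ ∞ (fun x => p x / ρ x) U := by
  have h1 : ContDiffOn ℝ ∞ (lapse ε R b) U :=
    ((contDiffOn_quad hS.smooth_shifted).div (contDiffOn_quad hS.smooth_b)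
      fun x hx => hS.quad_ne hx).congr fun _ hx => hS.lapse_eq hx
  exact (((contDiffOn_time (hS.smooth_aTime hρ)).div h1 hS.lapse_ne).sub
    contDiffOn_const).congr fun _ hx => hS.pressure_ratio hρ hx

/-- Under the ideal gas equations, the evolution of `p / ρ` is governed by a quadratic polynomial
with constant coefficients. -/
theorem pd_ratio_zero (hρ : ∀ x ∈ U, ρ x ≠ 0) {c₁ c₂ : ℝ} {x : Event} (hx : x ∈ U)
    (h : IdealGasEquations ε R b c₁ c₂ (x 0)) :
    pd 0 (fun y => p y / ρ y) x = -(deriv R (x 0) / R (x 0)) * aTime ε R b (x 0) *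
      (1 + c₂ * (1 + p x / ρ x) + c₁ * (1 + p x / ρ x) ^ 2) := by
  have hR := hS.R_ne _ (mem_times hx)
  have hl := hS.lapse_ne x hx
  have d1 := hS.denom_ne x hx
  have d2 := hS.shifted_w_ne hx
  have hD : R (x 0) * (slope R b (x 0) * wCoord ε x)
      = (1 + b (x 0) * wCoord ε x) - (1 + shifted R b (x 0) * wCoord ε x) := by
    rw [shifted]
    ring
  have e1 : slope R (aTime ε R b) (x 0) = -aTime ε R b (x 0) *
      (c₁ * aTime ε R b (x 0) ^ 2 + c₂ * aTime ε R b (x 0) + 1) / R (x 0) := by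
    field_simp
    linear_combination h.1
  have e2 : R (x 0) * slope R (slope R b) (x 0)
      = -c₁ * aTime ε R b (x 0) ^ 2 * slope R b (x 0) := by linear_combination h.2
  rw [(hS.hasGrad_ratio hρ hx).2 0, hS.pressure_ratio hρ hx]
  simp only [if_true]
  rw [hS.lapseLog_zero hx, hS.lapse_eq_w hx, e1]
  generalize 1 + b (x 0) * wCoord ε x = D₁ at *
  generalize 1 + shifted R b (x 0) * wCoord ε x = D₂ at *
  have e3 : slope R b (x 0) * wCoord ε x = (D₁ - D₂) / R (x 0) := by
    field_simp
    linear_combination hD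
  have e4 : -(R (x 0) * deriv R (x 0) * slope R (slope R b) (x 0)) * wCoord ε x
      = deriv R (x 0) * c₁ * aTime ε R b (x 0) ^ 2 * ((D₁ - D₂) / R (x 0)) := by
    rw [← e3]
    linear_combination -deriv R (x 0) * wCoord ε x * e2
  have e5 : deriv R (x 0) * slope R b (x 0) * wCoord ε x
      = deriv R (x 0) * ((D₁ - D₂) / R (x 0)) := by
    rw [← e3]
    ring
  rw [e4, e5]
  field_simp
  ring

/-- The converse: the thermodynamic quantities are found by quadratures in `p / ρ`. -/
theorem represents_of_equations (hρ : ∀ x ∈ U, ρ x ≠ 0) {k : ℝ} (hk : 0 < k) {c₁ c₂ : ℝ}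
    (h : ∀ t ∈ times U, IdealGasEquations ε R b c₁ c₂ t) :
    RepresentsIdealGas k (metric ε R b) (velocity ε R b) ρ p U := by
  have hI := isOpen_times hS.isOpen
  obtain ⟨t₀, ht₀, ha₀, hb₀⟩ := hS.exists_regular_time hρ
  have hev : ∀ t ∈ times U, ∀ᶠ s in 𝓝 t, IdealGasEquations ε R b c₁ c₂ s := fun t ht =>
    Filter.mem_of_superset (hI.mem_nhds ht) h
  have hreg : ∀ t ∈ times U, aTime ε R b t * slope R b t ≠ 0 := fun t ht =>
    (hS.regular_of_equations hρ (fun t ht _ _ _ => hev t ht) ht₀ ha₀ hb₀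
      (hev t₀ ht₀).frequently t ht).2
  set Q : ℝ → ℝ := fun v => 1 + c₂ * (1 + v) + c₁ * (1 + v) ^ 2 with hQ
  have hQs : ContDiff ℝ ∞ Q := by
    rw [hQ]
    fun_prop
  set O : Set ℝ := {v | (1 + v) * Q v ≠ 0} with hO
  have hOo : IsOpen O :=
    isOpen_ne_fun ((continuous_const.add continuous_id).mul hQs.continuous) continuous_const
  have hs1 : ContDiffOn ℝ ∞ (fun v => -3 * v / ((1 + v) * Q v)) O :=
    (contDiff_const.mul contDiff_id).contDiffOn.div
      ((contDiff_const.add contDiff_id).mul hQs).contDiffOn fun v hv => hv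
  have hs2 : ContDiffOn ℝ ∞ (fun v => 1 / Q v) O :=
    contDiffOn_const.div hQs.contDiffOn fun v hv => right_ne_zero_of_mul hv
  obtain ⟨G, hG⟩ := exists_antiderivative hOo hs1.continuousOn
  obtain ⟨H, hH⟩ := exists_antiderivative hOo hs2.continuousOn
  have hGs := contDiffOn_of_hasDerivAt hOo hG hs1
  have hHs := contDiffOn_of_hasDerivAt hOo hH hs2
  set q : Event → ℝ := fun x => p x / ρ x with hq
  have hqs : ContDiffOn ℝ ∞ q U := hS.contDiffOn_ratio hρ
  -- the thermodynamic quantities are singular where `u(p/ρ) = 0`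
  set V : Set Event := U ∩ q ⁻¹' {v | Q v ≠ 0} with hV
  have hVo : IsOpen V := hqs.continuousOn.isOpen_inter_preimage hS.isOpen
    (isOpen_ne_fun hQs.continuous continuous_const)
  have hVU : V ⊆ U := Set.inter_subset_left
  have hq1 : ∀ x ∈ U, 1 + q x = aTime ε R b (x 0) / lapse ε R b x := fun x hx => by
    have h := hS.pressure_ratio hρ hx
    rw [hq]
    linear_combination h
  have hq1ne : ∀ x ∈ U, 1 + q x ≠ 0 := fun x hx => by
    rw [hq1 x hx]
    exact div_ne_zero (left_ne_zero_of_mul (hreg _ (mem_times hx))) (hS.lapse_ne x hx)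
  have hqO : ∀ x ∈ V, q x ∈ O := fun x hx => mul_ne_zero (hq1ne x hx.1) hx.2
  have halong : ∀ x ∈ U, along (velocity ε R b) q x ≠ 0 → x ∈ V := by
    intro x hx hne
    refine ⟨hx, fun h0 => hne ?_⟩
    rw [along_velocity, hS.pd_ratio_zero hρ hx (h _ (mem_times hx)),
      show 1 + c₂ * (1 + p x / ρ x) + c₁ * (1 + p x / ρ x) ^ 2 = 0 from h0]
    simp
  have hdense : U ⊆ closure V := by
    intro x hx
    rw [mem_closure_iff]
    intro W hW hxW
    obtain ⟨F, hF, hgood⟩ := hS.finite_exceptional hρ (mem_times hx)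
      (left_ne_zero_of_mul (hreg _ (mem_times hx))) (right_ne_zero_of_mul (hreg _ (mem_times hx)))
    obtain ⟨y, hy, hy0, -, hyF⟩ := exists_generic_event (hW.inter hS.isOpen)
      (fun y hy => hS.conf_ne y hy.2) ⟨hxW, hx⟩ hF
    exact ⟨y, hy.1, halong y hy.2 (hgood y hy.2 hy0 hyF).1⟩
  have hρs : ContDiffOn ℝ ∞ ρ V := hS.contDiffOn_density.mono hVU
  have hlogs : ContDiffOn ℝ ∞ (fun x => Real.log (ρ x)) V := hρs.log fun x hx => hρ x (hVU hx)
  set r : Event → ℝ := fun x => Real.exp (Real.log (ρ x) + G (q x)) with hr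
  set s : Event → ℝ := fun x => k * (-Real.log (ρ x) + 3 * H (q x)) with hs
  have hr0 : ∀ x, r x ≠ 0 := fun x => Real.exp_ne_zero _
  have hrs : ContDiffOn ℝ ∞ r V := (hlogs.add (hGs.comp (hqs.mono hVU) hqO)).exp
  have hss : ContDiffOn ℝ ∞ s V :=
    contDiffOn_const.mul (hlogs.neg.add (contDiffOn_const.mul (hHs.comp (hqs.mono hVU) hqO)))
  have hps : ContDiffOn ℝ ∞ p V :=
    (hρs.mul (hqs.mono hVU)).congr fun x hx => (mul_div_cancel₀ _ (hρ x (hVU hx))).symm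
  have hqg : ∀ x ∈ V, HasGrad q (fun μ => pd μ q x) x := fun x hx =>
    hasGrad_of_differentiableAt (hS.hasGrad_ratio hρ (hVU hx)).1
  have hlg : ∀ x ∈ V, HasGrad (fun x => Real.log (ρ x)) (fun μ => (ρ x)⁻¹ * pd μ ρ x) x :=
    fun x hx => (hasGrad_of_differentiableAt (hS.hasGrad_density hρ (hVU hx)).1).comp
      (Real.hasDerivAt_log (hρ x (hVU hx)))
  have hrg : ∀ x ∈ V, HasGrad r (fun μ => r x * ((ρ x)⁻¹ * pd μ ρ x
      + -3 * q x / ((1 + q x) * Q (q x)) * pd μ q x)) x := fun x hx =>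
    ((hlg x hx).add ((hqg x hx).comp (hG _ (hqO x hx)))).comp (Real.hasDerivAt_exp _)
  have hsg : ∀ x ∈ V, HasGrad s (fun μ => k * (-((ρ x)⁻¹ * pd μ ρ x)
      + 3 * (1 / Q (q x) * pd μ q x))) x := fun x hx =>
    ((hasGrad_const k x).mul (((hasGrad_const 0 x).sub (hlg x hx)).add
      ((hasGrad_const 3 x).mul ((hqg x hx).comp (hH _ (hqO x hx)))))).congr
        (Filter.Eventually.of_forall fun y => by simp [hs]) |>.of_eq fun μ => by ring
  refine ⟨V, hVo, hVU, hdense, halong, r, fun x => ρ x / r x - 1, fun x => p x / (k * r x), s, ?_,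
    fun x hx => ?_⟩
  · refine ⟨hrs, (hρs.div hrs fun x _ => hr0 x).sub contDiffOn_const,
      hps.div (contDiffOn_const.mul hrs) fun x _ => mul_ne_zero hk.ne' (hr0 x), hss,
      fun x _ => Real.exp_pos _, fun x hx => hS.conservation hρ (hVU hx), fun x hx => ?_,
      fun x hx => ?_, fun x hx => ?_, fun x _ y _ h1 h2 => ?_⟩
    · have := hr0 x
      field_simp
      ring
    · have hxU := hVU hx
      have h1 := hq1 x hxU
      have h2 := hS.lapse_ne x hxU
      have h3 := hρ x hxU
      have h4 := left_ne_zero_of_mul (hreg _ (mem_times hxU))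
      have h5 : Q (q x) ≠ 0 := hx.2
      have h6 := hS.R_ne _ (mem_times hxU)
      rw [hS.matter_iff hxU (hrg x hx).1, (hrg x hx).2 0]
      beta_reduce
      rw [(hS.hasGrad_density hρ hxU).2 0, hS.pd_ratio_zero hρ hxU (h _ (mem_times hxU)),
        show 1 + c₂ * (1 + p x / ρ x) + c₁ * (1 + p x / ρ x) ^ 2 = Q (q x) from rfl]
      simp only [if_true]
      rw [← hS.density_eq hxU,
        show aTime ε R b (x 0) = (1 + q x) * lapse ε R b x by rw [h1]; field_simp]
      have h7 := hq1ne x hxU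
      generalize Q (q x) = Z at *
      generalize q x = v at *
      field_simp
      ring
    · have hxU := hVU hx
      have h3 := hρ x hxU
      have h1 := hq1ne x hxU
      have h5 : Q (q x) ≠ 0 := hx.2
      have hp : p x = ρ x * q x := (mul_div_cancel₀ _ h3).symm
      refine (gibbs_iff (T := fun x => p x / (k * r x)) (s := s) (p := p) hk.ne'
        (hrg x hx).1 (hS.hasGrad_density hρ hxU).1 (hr0 x)
        (Filter.Eventually.of_forall fun y => rfl) ?_).2 fun μ => ?_
      · have := hr0 x
        field_simp
      · have := hr0 x
        rw [(hrg x hx).2, (hsg x hx).2, hp]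
        beta_reduce
        generalize Q (q x) = Z at *
        generalize q x = v at *
        generalize r x = m at *
        field_simp
        ring
    · have hqe : q x = q y := by simp [hq, h1, h2]
      have hre : r x = r y := by simp [hr, h1, hqe]
      simp [hre, h1, h2, hs, hqe]
  · have := hr0 x
    field_simp

end ThermodynamicStephani

end

end

end Stephani

theorem theorem1 (ε : ℝ) (R b : ℝ → ℝ) (ρ p : Stephani.Event → ℝ) (U : Set Stephani.Event)
    (hS : Stephani.ThermodynamicStephani ε R b ρ p U)
    (hρ : ∀ x ∈ U, ρ x ≠ 0) (k : ℝ) (hk : 0 < k) :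
    (Stephani.RepresentsIdealGas k (Stephani.metric ε R b) (Stephani.velocity ε R b) ρ p U ↔
      ∃ c₁ c₂ : ℝ, ∀ x ∈ U,
        R (x 0) * Stephani.dR R (Stephani.aFun R ρ) x
            = -Stephani.aFun R ρ x *
                (c₁ * Stephani.aFun R ρ x ^ 2 + c₂ * Stephani.aFun R ρ x + 1) ∧
        Stephani.dR R (Stephani.dR R (Stephani.ofTime b)) x * R (x 0)
            = -c₁ * Stephani.aFun R ρ x ^ 2 * Stephani.dR R (Stephani.ofTime b) x) ∧
    (∀ x ∈ U, ρ x = 3 / R (x 0) ^ 2 * (deriv R (x 0) ^ 2 + ε - 4 * b (x 0) ^ 2)) := by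
  refine ⟨⟨fun h => ?_, fun h => ?_⟩, fun x hx => hS.density_eq hx⟩
  · obtain ⟨c₁, c₂, h⟩ := hS.equations_of_represents hρ hk h
    exact ⟨c₁, c₂, (hS.equations_iff hρ c₁ c₂).2 h⟩
  · obtain ⟨c₁, c₂, h⟩ := h
    exact hS.represents_of_equations hρ hk ((hS.equations_iff hρ c₁ c₂).1 h)
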